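/- Let $m,n\ge 1$ be integers and let $X\subset\mathbf R^{m+1}$ be a smooth closed strictly convex hypersurface, i.e. a smooth ($C^\infty$) embedded hypersurface that is the boundary of a compact strictly convex set with non-empty interior. Indices are taken modulo $n$. Let $$G(X,n)=\{(x_1,\dots,x_n)\in X^{\times n}: x_i\neq x_{i+1},\ i=1,\dots,n\}$$ be the cyclic configuration space, with the action of the dihedral group $D_n$ generated by $(x_1,\dots,x_n)\mapsto(x_2,\dots,x_n,x_1)$ and $(x_1,\dots,x_n)\mapsto(x_n,\dots,x_1)$. Let $L_X:G(X,n)\to\mathbf R$, $L_X(x_1,\dots,x_n)=-\sum_{i=1}^n|x_i-x_{i+1}|$, be the perimeter length taken with the minus sign, and for $\varepsilon>0$ let $$G_\varepsilon(X,n)=\Big\{(x_1,\dots,x_n)\in X^{\times n}:\ \prod_{i=1}^n|x_i-x_{i+1}|\ge\varepsilon\Big\}\subset G(X,n).$$ The manifold $G(X,n)$ carries the Riemannian metric induced from $(\mathbf R^{m+1})^n$. There is $\varepsilon_0>0$ such that for every $\varepsilon$ with $0<\varepsilon<\varepsilon_0$: (a) $G_\varepsilon(X,n)$ is a smooth $mn$-dimensional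 manifold with boundary, smoothly embedded in $(\mathbf R^{m+1})^n$, and its boundary is $\partial G_\varepsilon(X,n)=\{(x_1,\dots,x_n)\in X^{\times n}:\prod_{i=1}^n|x_i-x_{i+1}|=\varepsilon\}$; (b) the inclusion $G_\varepsilon(X,n)\subset G(X,n)$ is a $D_n$-equivariant homotopy equivalence, i.e. it is equivariant and has an equivariant homotopy inverse, with homotopies through equivariant maps; (c) all critical points of $L_X:G(X,n)\to\mathbf R$ are contained in $G_\varepsilon(X,n)$; (d) at every point of $\partial G_\varepsilon(X,n)$ the gradient of $L_X$ has the outward direction: it is not tangent to $\partial G_\varepsilon(X,n)$, and it is the velocity at time $0$ of a smooth curve that lies in $G_\varepsilon(X,n)$ for small times $t\le 0$. -/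

import Mathlib

open scoped Manifold ContDiff Topology unitInterval

noncomputable section

namespace Billiard

/-! ### Subsets of a Euclidean space: hypersurfaces, tangent spaces, manifolds with boundary -/

section Submanifolds

variable {V : Type*} [NormedAddCommGroup V] [InnerProductSpace ℝ V]

/-- `X` is a smooth embedded hypersurface (without boundary): near each of its points, `X` is the
zero set of a smooth function with nonvanishing differential at the point. -/
def IsSmoothHypersurface (X : Set V) : Prop :=
  ∀ p ∈ X, ∃ (U : Set V) (f : V → ℝ), IsOpen U ∧ p ∈ U ∧ ContDiffOn ℝ ∞ f U ∧
    fderiv ℝ f p ≠ 0 ∧ X ∩ U = {x ∈ U | f x = 0}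

/-- `X` is a smooth closed strictly convex hypersurface: a smooth hypersurface that is the boundary
of a compact strictly convex body (the billiard table). -/
structure IsClosedStrictlyConvexHypersurface (X : Set V) : Prop where
  smooth : IsSmoothHypersurface X
  table : ∃ K : Set V, IsCompact K ∧ StrictConvex ℝ K ∧ (interior K).Nonempty ∧ X = frontier K

/-- The tangent space at `p` of a smooth submanifold `S ⊆ V` without boundary: the velocities at
`p` of the smooth curves in `S` through `p`. (For a submanifold these velocities already form a
linear subspace; the span only serves to have a `Submodule` for every set `S`.) -/
def tangentSpaceOf (S : Set V) (p : V) : Submodule ℝ V :=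
  Submodule.span ℝ {v | ∃ γ : ℝ → V, ContDiffAt ℝ ∞ γ 0 ∧ γ 0 = p ∧
    (∀ᶠ t in 𝓝 (0 : ℝ), γ t ∈ S) ∧ deriv γ 0 = v}

/-- The point `p` is a critical point of the restriction to the submanifold `S` of a function `f`
that is defined on `V` and differentiable at `p`. -/
def IsCriticalPointOn (f : V → ℝ) (S : Set V) (p : V) : Prop :=
  p ∈ S ∧ ∀ v ∈ tangentSpaceOf S p, fderiv ℝ f p v = 0

/-- The Riemannian gradient at `p` of the restriction to the submanifold `S` of a function `f` that
is defined on `V` and differentiable at `p`, for the metric on `S` induced from `V`: the tangent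
vector that represents the differential of `f` on the tangent space. -/
def gradientOn [FiniteDimensional ℝ V] (f : V → ℝ) (S : Set V) (p : V) : V :=
  haveI : CompleteSpace (tangentSpaceOf S p) := FiniteDimensional.complete ℝ _
  ((InnerProductSpace.toDual ℝ (tangentSpaceOf S p)).symm
    ((fderiv ℝ f p).comp (tangentSpaceOf S p).subtypeL) : tangentSpaceOf S p)

/-- The set `M ⊆ V` is a smooth embedded `d`-dimensional submanifold with boundary of `V`, and its
boundary is `B`: the space `M`, with the subspace topology, carries a smooth structure of a
`d`-manifold with boundary for which the inclusion in `V` is a smooth embedding and whose set of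
boundary points is `B`. -/
def IsSmoothSubmanifoldWithBoundary (d : ℕ) [NeZero d] (M B : Set V) : Prop :=
  ∃ _ : ChartedSpace (EuclideanHalfSpace d) M,
    IsManifold (𝓡∂ d) ∞ M ∧
    Manifold.IsSmoothEmbedding (𝓡∂ d) 𝓘(ℝ, V) ∞ (Subtype.val : M → V) ∧
    Subtype.val '' ((𝓡∂ d).boundary M) = B

/-- The vector `v`, at the boundary point `p` of the submanifold `M` with boundary `B`, has the
outward direction: it is the velocity of a smooth curve that lies in `M` for small times `t ≤ 0`
and is at `p` at time `0`, and it is not tangent to the boundary. -/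
def IsOutwardAt (M B : Set V) (p v : V) : Prop :=
  v ∉ tangentSpaceOf B p ∧
    ∃ γ : ℝ → V, ContDiffAt ℝ ∞ γ 0 ∧ γ 0 = p ∧ (∀ᶠ t in 𝓝[≤] (0 : ℝ), γ t ∈ M) ∧ deriv γ 0 = v

end Submanifolds

/-! ### Equivariant homotopy equivalences -/

section Equivariant

variable {A B : Type*} [TopologicalSpace A] [TopologicalSpace B]

/-- The maps `f₀` and `f₁` are homotopic through `Γ`-equivariant maps. -/
def EquivariantlyHomotopic (Γ : Type*) [Group Γ] [MulAction Γ A] [MulAction Γ B]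
    (f₀ f₁ : C(A, B)) : Prop :=
  ∃ H : f₀.Homotopy f₁, ∀ (t : I) (γ : Γ) (a : A), H (t, γ • a) = γ • H (t, a)

/-- The map `f` is a `Γ`-equivariant homotopy equivalence: it is equivariant and has an equivariant
homotopy inverse, with equivariant homotopies. -/
def IsEquivariantHomotopyEquiv (Γ : Type*) [Group Γ] [MulAction Γ A] [MulAction Γ B]
    (f : C(A, B)) : Prop :=
  (∀ (γ : Γ) (a : A), f (γ • a) = γ • f a) ∧
    ∃ g : C(B, A), (∀ (γ : Γ) (b : B), g (γ • b) = γ • g b) ∧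
      EquivariantlyHomotopic Γ (g.comp f) (ContinuousMap.id A) ∧
      EquivariantlyHomotopic Γ (f.comp g) (ContinuousMap.id B)

end Equivariant

/-! ### Polygons and the cyclic configuration space -/

/-- The Euclidean space of all `n`-tuples of points of `ℝ^(m+1)`, with cyclic indices. -/
abbrev Polygon (m n : ℕ) : Type :=
  PiLp 2 (fun _ : ZMod n => EuclideanSpace ℝ (Fin (m + 1)))

/-- The dihedral group permutes the vertices of a polygon: the rotation `r 1` is
`(x₁, …, xₙ) ↦ (x₂, …, xₙ, x₁)` and the reflection `sr 1` is `(x₁, …, xₙ) ↦ (xₙ, …, x₁)`. -/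
instance polygonAction (m n : ℕ) : MulAction (DihedralGroup n) (Polygon m n) where
  smul g x := match g with
    | .r a => WithLp.toLp 2 fun i => x (i + a)
    | .sr a => WithLp.toLp 2 fun i => x (a - i)
  one_smul x := by
    ext1 i
    change x (i + 0) = x i
    rw [add_zero]
  mul_smul g h x := by
    rcases g with a | a <;> rcases h with b | b <;> ext1 i
    · change x (i + (a + b)) = x (i + a + b)
      rw [add_assoc]
    · change x (b - a - i) = x (b - (i + a))
      exact congrArg x.ofLp (by ring)
    · change x (a + b - i) = x (a - i + b)
      exact congrArg x.ofLp (by ring)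
    · change x (i + (b - a)) = x (b - (a - i))
      exact congrArg x.ofLp (by ring)

lemma r_smul_apply {m n : ℕ} (a : ZMod n) (x : Polygon m n) (i : ZMod n) :
    (DihedralGroup.r a • x) i = x (i + a) := rfl

lemma sr_smul_apply {m n : ℕ} (a : ZMod n) (x : Polygon m n) (i : ZMod n) :
    (DihedralGroup.sr a • x) i = x (a - i) := rfl

section Configurations

variable {m n : ℕ}

/-- The cyclic configuration space `G(X, n)`. -/
def cyclicConfig (X : Set (EuclideanSpace ℝ (Fin (m + 1)))) (n : ℕ) : Set (Polygon m n) :=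
  {x | (∀ i, x i ∈ X) ∧ ∀ i, x i ≠ x (i + 1)}

variable [NeZero n]

/-- The product of the lengths of the sides of a polygon. -/
def sideProduct (x : Polygon m n) : ℝ := ∏ i, dist (x i) (x (i + 1))

/-- The perimeter length, taken with the minus sign. -/
def negPerimeter (x : Polygon m n) : ℝ := -∑ i, dist (x i) (x (i + 1))

/-- The truncated cyclic configuration space `G_ε(X, n)`. -/
def truncatedConfig (X : Set (EuclideanSpace ℝ (Fin (m + 1)))) (n : ℕ) [NeZero n] (ε : ℝ) :
    Set (Polygon m n) :=
  {x | (∀ i, x i ∈ X) ∧ ε ≤ sideProduct x}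

/-- The boundary `∂G_ε(X, n)`. -/
def truncatedConfigBoundary (X : Set (EuclideanSpace ℝ (Fin (m + 1)))) (n : ℕ) [NeZero n]
    (ε : ℝ) : Set (Polygon m n) :=
  {x | (∀ i, x i ∈ X) ∧ sideProduct x = ε}

lemma truncatedConfig_subset (X : Set (EuclideanSpace ℝ (Fin (m + 1)))) (n : ℕ) [NeZero n]
    {ε : ℝ} (hε : 0 < ε) : truncatedConfig X n ε ⊆ cyclicConfig X n := by
  rintro x ⟨hx, h⟩
  refine ⟨hx, fun i hi => ?_⟩
  have h0 : sideProduct x = 0 :=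
    Finset.prod_eq_zero (Finset.mem_univ i) (dist_eq_zero.2 hi)
  linarith

lemma sideProduct_smul (g : DihedralGroup n) (x : Polygon m n) :
    sideProduct (g • x) = sideProduct x := by
  rcases g with a | a
  · refine Fintype.prod_equiv (Equiv.addRight a) _ _ fun i => ?_
    simp only [r_smul_apply, Equiv.coe_addRight]
    rw [add_right_comm]
  · refine Fintype.prod_equiv (Equiv.subLeft (a - 1)) _ _ fun i => ?_
    simp only [sr_smul_apply, Equiv.subLeft_apply]
    rw [dist_comm, show a - (i + 1) = a - 1 - i by ring, show a - i = a - 1 - i + 1 by ring]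

lemma smul_mem_cyclicConfig {m n : ℕ} {X : Set (EuclideanSpace ℝ (Fin (m + 1)))}
    (g : DihedralGroup n) {x : Polygon m n} (hx : x ∈ cyclicConfig X n) :
    g • x ∈ cyclicConfig X n := by
  rcases g with a | a
  · refine ⟨fun i => hx.1 _, fun i => ?_⟩
    rw [r_smul_apply, r_smul_apply, add_right_comm]
    exact hx.2 _
  · refine ⟨fun i => hx.1 _, fun i h => hx.2 (a - (i + 1)) ?_⟩
    rw [sr_smul_apply, sr_smul_apply] at h
    rw [show a - (i + 1) + 1 = a - i by ring]
    exact h.symm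

lemma smul_mem_truncatedConfig {X : Set (EuclideanSpace ℝ (Fin (m + 1)))} {ε : ℝ}
    (g : DihedralGroup n) {x : Polygon m n} (hx : x ∈ truncatedConfig X n ε) :
    g • x ∈ truncatedConfig X n ε := by
  refine ⟨?_, (sideProduct_smul g x).symm ▸ hx.2⟩
  rcases g with a | a <;> exact fun i => hx.1 _

instance cyclicConfigAction (m n : ℕ) (X : Set (EuclideanSpace ℝ (Fin (m + 1)))) :
    MulAction (DihedralGroup n) (cyclicConfig X n) where
  smul g x := ⟨g • x.1, smul_mem_cyclicConfig g x.2⟩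
  one_smul x := Subtype.ext (one_smul _ x.1)
  mul_smul g h x := Subtype.ext (mul_smul g h x.1)

instance truncatedConfigAction (m n : ℕ) [NeZero n] (X : Set (EuclideanSpace ℝ (Fin (m + 1))))
    (ε : ℝ) : MulAction (DihedralGroup n) (truncatedConfig X n ε) where
  smul g x := ⟨g • x.1, smul_mem_truncatedConfig g x.2⟩
  one_smul x := Subtype.ext (one_smul _ x.1)
  mul_smul g h x := Subtype.ext (mul_smul g h x.1)

end Configurations

end Billiard

end

/-! Let `P` be the product of the sides. Everything rests on one inequality
(`exists_fderiv_negPerimeter_neg`): for some `ε₀ > 0`, the gradients of `L_X` and of `log P` on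
`G(X, n)` have a negative scalar product wherever `P < ε₀`. Then `P` has no critical points there,
so the level `P = ε` is regular, which gives (a). Nor has `L_X`, which gives (c). Along the gradient
of `L_X` the function `P` decreases, which gives (d). And small values of `P` can be pushed up
equivariantly, which gives (b).

For the inequality, the scalar product is minus the sum of the local terms `vertexForm`. At a vertex
with adjacent sides of lengths `d`, `d'`, let `A`, `B` be the lengths of the tangential parts of the
unit side vectors. The term is `(A - B) (A / d - B / d')` plus a nonnegative Cauchy–Schwarz defect
times `1 / d + 1 / d'`. A chord deviates from the tangent space to second order, so `1 - A ^ 2 ≤ C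
d`, and every term is at least `-C`. If the sum were nonpositive, every term would be at most `n C`.
Strict convexity keeps long chords at an angle bounded below from the tangent space, and so a short
side would force the next side to be short and nearly parallel to it (`exists_norm_sub_le`). Going
once around, all sides would point in nearly the same direction, which is impossible for a closed
polygon (`exists_sum_vertexForm_pos`).

To do calculus, `X` is written as the regular zero set of a global smooth function
(`exists_definingFunction`). The homotopy equivalence comes from a smooth field tangent to `X ^ n`
along which `P ^ 2` never decreases. Its time-one flow is iterated and stopped at an invariant time
(`exists_semiflow`, `isEquivariantHomotopyEquiv_of_step`). -/

noncomputable section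

namespace Billiard

/-! ### Submanifolds with boundary from local straightenings of the ambient space. -/

section Straightening

variable {V : Type*} [NormedAddCommGroup V] [InnerProductSpace ℝ V]
  {F : Type*} [NormedAddCommGroup F] [NormedSpace ℝ F]

/-- A local diffeomorphism of `V` near `p` that takes the set `M` to a half-space of a coordinate
subspace, and its subset `B` to the boundary of the half-space. -/
structure BoundaryStraightening (d : ℕ) [NeZero d] (F : Type*) [NormedAddCommGroup F]
    [NormedSpace ℝ F] (M B : Set V) (p : V) where
  toHomeo : OpenPartialHomeomorph V (EuclideanSpace ℝ (Fin d) × F)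
  mem_source : p ∈ toHomeo.source
  contDiffOn : ContDiffOn ℝ ∞ toHomeo toHomeo.source
  contDiffOn_symm : ContDiffOn ℝ ∞ toHomeo.symm toHomeo.target
  mem_iff : ∀ x ∈ toHomeo.source, x ∈ M ↔ 0 ≤ (toHomeo x).1 0 ∧ (toHomeo x).2 = 0
  mem_boundary_iff : ∀ x ∈ toHomeo.source, x ∈ M → (x ∈ B ↔ (toHomeo x).1 0 = 0)

namespace BoundaryStraightening

variable {d : ℕ} [NeZero d] {M B : Set V} {p : V}

lemma symm_mem (s : BoundaryStraightening d F M B p) {h : EuclideanHalfSpace d}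
    (hh : ((h.1, 0) : EuclideanSpace ℝ (Fin d) × F) ∈ s.toHomeo.target) :
    s.toHomeo.symm (h.1, 0) ∈ M := by
  rw [s.mem_iff _ (s.toHomeo.map_target hh), s.toHomeo.right_inv hh]
  exact ⟨h.2, rfl⟩

open Classical in
/-- The chart of `M` with values in the half-space given by a straightening. -/
def chart (s : BoundaryStraightening d F M B p) (hp : p ∈ M) :
    OpenPartialHomeomorph M (EuclideanHalfSpace d) where
  toFun x := (𝓡∂ d).symm (s.toHomeo x.1).1
  invFun h := if hh : ((h.1, 0) : EuclideanSpace ℝ (Fin d) × F) ∈ s.toHomeo.target then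
    ⟨s.toHomeo.symm (h.1, 0), s.symm_mem hh⟩ else ⟨p, hp⟩
  source := Subtype.val ⁻¹' s.toHomeo.source
  target := {h | ((h.1, 0) : EuclideanSpace ℝ (Fin d) × F) ∈ s.toHomeo.target}
  map_source' x hx := by
    have hx' := (s.mem_iff x.1 hx).1 x.2
    have h1 : ((𝓡∂ d).symm (s.toHomeo x.1).1).1 = (s.toHomeo x.1).1 :=
      (𝓡∂ d).right_inv (by rw [range_modelWithCornersEuclideanHalfSpace]; exact hx'.1)
    change (((𝓡∂ d).symm (s.toHomeo x.1).1).1, (0 : F)) ∈ s.toHomeo.target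
    rw [h1, ← hx'.2]
    exact s.toHomeo.map_source hx
  map_target' h hh := by
    change ((h.1, 0) : EuclideanSpace ℝ (Fin d) × F) ∈ s.toHomeo.target at hh
    simp only [hh, dite_true]
    exact s.toHomeo.map_target hh
  left_inv' x hx := by
    have hx' := (s.mem_iff x.1 hx).1 x.2
    have h1 : ((𝓡∂ d).symm (s.toHomeo x.1).1).1 = (s.toHomeo x.1).1 :=
      (𝓡∂ d).right_inv (by rw [range_modelWithCornersEuclideanHalfSpace]; exact hx'.1)
    have h2 : (((𝓡∂ d).symm (s.toHomeo x.1).1).1, (0 : F)) = s.toHomeo x.1 := by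
      rw [h1, ← hx'.2]
    apply Subtype.ext
    simp only [h2, s.toHomeo.map_source hx, dite_true]
    exact s.toHomeo.left_inv hx
  right_inv' h hh := by
    change ((h.1, 0) : EuclideanSpace ℝ (Fin d) × F) ∈ s.toHomeo.target at hh
    simp only [hh, dite_true]
    rw [s.toHomeo.right_inv hh]
    exact (𝓡∂ d).left_inv h
  open_source := s.toHomeo.open_source.preimage continuous_subtype_val
  open_target := s.toHomeo.open_target.preimage
    (continuous_subtype_val.prodMk continuous_const)
  continuousOn_toFun := by
    refine (𝓡∂ d).continuous_symm.comp_continuousOn (continuous_fst.comp_continuousOn ?_)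
    exact s.toHomeo.continuousOn.comp continuous_subtype_val.continuousOn fun x hx => hx
  continuousOn_invFun := by
    rw [Topology.IsInducing.subtypeVal.continuousOn_iff]
    refine ContinuousOn.congr (f := fun h : EuclideanHalfSpace d => s.toHomeo.symm (h.1, 0)) ?_ ?_
    · exact s.toHomeo.continuousOn_symm.comp
        (continuous_subtype_val.prodMk continuous_const).continuousOn fun h hh => hh
    · intro h hh
      change ((h.1, 0) : EuclideanSpace ℝ (Fin d) × F) ∈ s.toHomeo.target at hh
      simp [hh]

lemma mem_chart_source (s : BoundaryStraightening d F M B p) (hp : p ∈ M) {x : M} :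
    x ∈ (s.chart hp).source ↔ x.1 ∈ s.toHomeo.source := Iff.rfl

lemma mem_chart_target (s : BoundaryStraightening d F M B p) (hp : p ∈ M)
    {h : EuclideanHalfSpace d} :
    h ∈ (s.chart hp).target ↔
      ((h.1, 0) : EuclideanSpace ℝ (Fin d) × F) ∈ s.toHomeo.target := Iff.rfl

lemma coe_chart_apply (s : BoundaryStraightening d F M B p) (hp : p ∈ M) {x : M}
    (hx : x.1 ∈ s.toHomeo.source) : (s.chart hp x).1 = (s.toHomeo x.1).1 :=
  (𝓡∂ d).right_inv
    (by rw [range_modelWithCornersEuclideanHalfSpace]; exact ((s.mem_iff x.1 hx).1 x.2).1)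

lemma coe_chart_symm_apply (s : BoundaryStraightening d F M B p) (hp : p ∈ M)
    {h : EuclideanHalfSpace d}
    (hh : ((h.1, 0) : EuclideanSpace ℝ (Fin d) × F) ∈ s.toHomeo.target) :
    ((s.chart hp).symm h).1 = s.toHomeo.symm (h.1, 0) :=
  congrArg Subtype.val (dif_pos hh)

lemma contDiffOn_transition {p q : V} (s : BoundaryStraightening d F M B p) (hp : p ∈ M)
    (t : BoundaryStraightening d F M B q) (hq : q ∈ M) :
    ContDiffOn ℝ ∞ ((𝓡∂ d) ∘ ((s.chart hp).symm.trans (t.chart hq)) ∘ (𝓡∂ d).symm)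
      ((𝓡∂ d).symm ⁻¹' ((s.chart hp).symm.trans (t.chart hq)).source ∩ Set.range (𝓡∂ d)) := by
  have key : ∀ h : EuclideanHalfSpace d, h ∈ ((s.chart hp).symm.trans (t.chart hq)).source →
      ((h.1, 0) : EuclideanSpace ℝ (Fin d) × F) ∈ s.toHomeo.target ∧
      s.toHomeo.symm (h.1, 0) ∈ t.toHomeo.source := by
    intro h hh
    rw [OpenPartialHomeomorph.trans_source] at hh
    have h1 := (s.mem_chart_target hp).1 hh.1
    refine ⟨h1, ?_⟩
    rw [← s.coe_chart_symm_apply hp h1]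
    exact hh.2
  have hr : ∀ y ∈ Set.range (𝓡∂ d), ((𝓡∂ d).symm y).1 = y := fun y hy => (𝓡∂ d).right_inv hy
  refine ContDiffOn.congr (f := fun y => (t.toHomeo (s.toHomeo.symm (y, 0))).1) ?_ ?_
  · refine contDiff_fst.comp_contDiffOn (t.contDiffOn.comp (s.contDiffOn_symm.comp
      (contDiff_id.prodMk contDiff_const).contDiffOn ?_) ?_)
    · rintro y ⟨hy, hy'⟩
      have := (key _ hy).1
      rwa [hr y hy'] at this
    · rintro y ⟨hy, hy'⟩
      have := (key _ hy).2
      rwa [hr y hy'] at this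
  · rintro y ⟨hy, hy'⟩
    have h1 := key _ hy
    simp only [Function.comp_apply, OpenPartialHomeomorph.coe_trans]
    change (t.chart hq ((s.chart hp).symm ((𝓡∂ d).symm y))).1 = _
    rw [t.coe_chart_apply hq, s.coe_chart_symm_apply hp h1.1, hr y hy']
    rw [s.coe_chart_symm_apply hp h1.1]
    exact h1.2

end BoundaryStraightening

lemma mem_maximalAtlas_of_contDiffOn {V : Type*} [NormedAddCommGroup V] [NormedSpace ℝ V]
    (e : OpenPartialHomeomorph V V) (h : ContDiffOn ℝ ∞ e e.source)
    (h' : ContDiffOn ℝ ∞ e.symm e.target) :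
    e ∈ IsManifold.maximalAtlas 𝓘(ℝ, V) ∞ V := by
  apply StructureGroupoid.mem_maximalAtlas_of_mem_groupoid
  rw [contDiffGroupoid, mem_groupoid_of_pregroupoid]
  simp only [contDiffPregroupoid, modelWithCornersSelf_coe, modelWithCornersSelf_coe_symm]
  simpa using ⟨h, h'⟩

/-- Straightenings restrict to charts of `M` with smooth transition maps. In the straightened
ambient coordinates the inclusion reads `h ↦ (h, 0)`, so it is an immersion with complement `F`. The
equality of dimensions provides the isomorphism `A`, which turns these coordinates into charts with
values in `V`. -/
theorem isSmoothSubmanifoldWithBoundary_of_straightening [FiniteDimensional ℝ V]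
    [FiniteDimensional ℝ F] {d : ℕ} [NeZero d] {M B : Set V} (hBM : B ⊆ M)
    (hd : Module.finrank ℝ V = d + Module.finrank ℝ F)
    (S : ∀ p ∈ M, Nonempty (BoundaryStraightening d F M B p)) :
    IsSmoothSubmanifoldWithBoundary d M B := by
  let S := fun p : M => (S p.1 p.2).some
  let cs : ChartedSpace (EuclideanHalfSpace d) M :=
    { atlas := Set.range fun p => (S p).chart p.2
      chartAt := fun p => (S p).chart p.2
      mem_chart_source := fun p => (S p).mem_source
      chart_mem_atlas := fun p => ⟨p, rfl⟩ }
  have hman : IsManifold (𝓡∂ d) ∞ M := by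
    apply isManifold_of_contDiffOn
    rintro _ _ ⟨p, rfl⟩ ⟨q, rfl⟩
    exact (S p).contDiffOn_transition p.2 (S q) q.2
  have hr : ∀ y ∈ Set.range (𝓡∂ d), ((𝓡∂ d).symm y).1 = y := fun y hy => (𝓡∂ d).right_inv hy
  have hfin : Module.finrank ℝ (EuclideanSpace ℝ (Fin d) × F) = Module.finrank ℝ V := by
    rw [Module.finrank_prod, finrank_euclideanSpace_fin, hd]
  let A : (EuclideanSpace ℝ (Fin d) × F) ≃L[ℝ] V := ContinuousLinearEquiv.ofFinrankEq hfin
  refine ⟨cs, hman, ⟨?_, Topology.IsEmbedding.subtypeVal⟩, ?_⟩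
  · suffices h : Manifold.IsImmersionOfComplement F (𝓡∂ d) 𝓘(ℝ, V) ∞ (Subtype.val : M → V) from
      h.isImmersion
    intro p
    let c : OpenPartialHomeomorph V V :=
      (S p).toHomeo.trans A.toHomeomorph.toOpenPartialHomeomorph
    have hcs : c.source = (S p).toHomeo.source := by simp [c]
    have hct : c.target = A.symm ⁻¹' (S p).toHomeo.target := by
      ext x
      simp [c]
    refine Manifold.IsImmersionAtOfComplement.mk_of_charts A ((S p).chart p.2) c
      (S p).mem_source ?_ ?_ ?_ ?_ ?_
    · rw [hcs]; exact (S p).mem_source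
    · exact IsManifold.chart_mem_maximalAtlas p
    · apply mem_maximalAtlas_of_contDiffOn
      · rw [hcs]
        exact A.contDiff.comp_contDiffOn (S p).contDiffOn
      · rw [hct]
        exact (S p).contDiffOn_symm.comp A.symm.contDiff.contDiffOn fun x hx => hx
    · intro x hx
      change x.1 ∈ c.source
      rw [hcs]; exact hx
    · intro y hy
      rw [OpenPartialHomeomorph.extend_target] at hy
      have h1 := ((S p).mem_chart_target p.2).1 hy.1
      simp only [Function.comp_apply, OpenPartialHomeomorph.extend_coe,
        OpenPartialHomeomorph.extend_coe_symm, modelWithCornersSelf_coe, id]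
      rw [(S p).coe_chart_symm_apply p.2 h1]
      change A ((S p).toHomeo _) = _
      rw [(S p).toHomeo.right_inv h1, hr y hy.2]
  · ext x
    constructor
    · rintro ⟨p, hp, rfl⟩
      have h1 : (𝓡∂ d) ((S p).chart p.2 p) ∈ frontier (Set.range (𝓡∂ d)) := by
        have := ModelWithCorners.isBoundaryPoint_iff.1 hp
        exact this
      rw [frontier_range_modelWithCornersEuclideanHalfSpace] at h1
      change (0 : ℝ) = ((S p).chart p.2 p).1 0 at h1
      rw [(S p).coe_chart_apply p.2 (S p).mem_source] at h1
      exact ((S p).mem_boundary_iff _ (S p).mem_source p.2).2 h1.symm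
    · intro hx
      refine ⟨⟨x, hBM hx⟩, ?_, rfl⟩
      set p : M := ⟨x, hBM hx⟩
      have h1 := ((S p).mem_boundary_iff _ (S p).mem_source p.2).1 hx
      have : (𝓡∂ d) ((S p).chart p.2 p) ∈ frontier (Set.range (𝓡∂ d)) := by
        rw [frontier_range_modelWithCornersEuclideanHalfSpace]
        change (0 : ℝ) = ((S p).chart p.2 p).1 0
        rw [(S p).coe_chart_apply p.2 (S p).mem_source]
        exact h1.symm
      exact ModelWithCorners.isBoundaryPoint_iff.2 this

end Straightening

/-! ### Regular level sets via the inverse function theorem. -/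

section RegularSets

/-- The inverse function theorem, with a local inverse that is smooth on an open set. -/
lemma exists_openPartialHomeomorph_contDiffOn {V W : Type*} [NormedAddCommGroup V] [NormedSpace ℝ V]
    [NormedAddCommGroup W] [NormedSpace ℝ W] [FiniteDimensional ℝ V] {f : V → W}
    (hf : ContDiff ℝ ∞ f) (p : V) (A : V ≃L[ℝ] W) (hA : fderiv ℝ f p = A) {U : Set V}
    (hU : IsOpen U) (hp : p ∈ U) :
    ∃ e : OpenPartialHomeomorph V W, ⇑e = f ∧ p ∈ e.source ∧ e.source ⊆ U ∧
      ContDiffOn ℝ ∞ e.symm e.target := by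
  have : CompleteSpace V := FiniteDimensional.complete ℝ V
  have hAd : HasFDerivAt f (A : V →L[ℝ] W) p := by
    rw [← hA]; exact (hf.differentiable (by simp) p).hasFDerivAt
  let e₀ := hf.contDiffAt.toOpenPartialHomeomorph f hAd (by simp : (∞ : WithTop ℕ∞) ≠ 0)
  -- Where the differential is invertible the local inverse is smooth. Restricting to this open set
  -- gives smoothness on the whole target, not only at the image of `p`.
  let O : Set V := (fderiv ℝ f ⁻¹' Set.range ((↑) : (V ≃L[ℝ] W) → V →L[ℝ] W)) ∩ U
  have hO : IsOpen O :=
    (ContinuousLinearEquiv.isOpen.preimage (hf.continuous_fderiv (by simp))).inter hU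
  have hpO : p ∈ O := ⟨⟨A, hA.symm⟩, hp⟩
  have hcoe : ⇑(e₀.restrOpen O hO) = f := by
    exact hf.contDiffAt.toOpenPartialHomeomorph_coe hAd (by simp)
  have hsrc : (e₀.restrOpen O hO).source = e₀.source ∩ O := e₀.restrOpen_source O hO
  refine ⟨e₀.restrOpen O hO, hcoe, ?_, ?_, ?_⟩
  · rw [hsrc]
    exact ⟨hf.contDiffAt.mem_toOpenPartialHomeomorph_source hAd (by simp), hpO⟩
  · rw [hsrc]; exact fun x hx => hx.2.2
  · intro y hy
    have hx := (e₀.restrOpen O hO).map_target hy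
    rw [hsrc] at hx
    obtain ⟨B, hB⟩ := hx.2.1
    refine ((e₀.restrOpen O hO).contDiffAt_symm (f₀' := B) hy ?_ ?_).contDiffWithinAt
    · rw [hcoe, hB]; exact (hf.differentiable (by simp) _).hasFDerivAt
    · rw [hcoe]; exact hf.contDiffAt

variable {V : Type*} [NormedAddCommGroup V] [InnerProductSpace ℝ V] [FiniteDimensional ℝ V]
  {F : Type*} [NormedAddCommGroup F] [NormedSpace ℝ F] [FiniteDimensional ℝ F]

/-- The functions `s` and `G` become coordinates. The missing ones come from the orthogonal
projection to the common kernel of their differentials, which `J` identifies with the hyperplane of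
vectors of `EuclideanSpace ℝ (Fin d)` with vanishing coordinate `0`. -/
lemma nonempty_boundaryStraightening {d : ℕ} [NeZero d]
    (hd : Module.finrank ℝ V = d + Module.finrank ℝ F) {G : V → F} {s : V → ℝ}
    (hG : ContDiff ℝ ∞ G) (hs : ContDiff ℝ ∞ s) {M B U : Set V} {p : V} (hU : IsOpen U)
    (hp : p ∈ U) (hM : ∀ x ∈ U, x ∈ M ↔ 0 ≤ s x ∧ G x = 0)
    (hB : ∀ x ∈ U, x ∈ M → (x ∈ B ↔ s x = 0))
    (hsurj : Function.Surjective ((fderiv ℝ s p).prod (fderiv ℝ G p))) :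
    Nonempty (BoundaryStraightening d F M B p) := by
  set D := (fderiv ℝ s p).prod (fderiv ℝ G p) with hD
  let π₀ : EuclideanSpace ℝ (Fin d) →L[ℝ] ℝ := EuclideanSpace.proj 0
  let e₀ : EuclideanSpace ℝ (Fin d) := EuclideanSpace.single 0 1
  have he₀ : π₀ e₀ = 1 := by simp [π₀, e₀]
  have hfin : Module.finrank ℝ (LinearMap.ker D.toLinearMap) =
      Module.finrank ℝ (LinearMap.ker π₀.toLinearMap) := by
    have h1 := D.toLinearMap.finrank_range_add_finrank_ker
    have h2 := π₀.toLinearMap.finrank_range_add_finrank_ker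
    rw [LinearMap.range_eq_top.2 hsurj, finrank_top, Module.finrank_prod, Module.finrank_self] at h1
    have h3 : Function.Surjective π₀.toLinearMap := fun c => ⟨c • e₀, by simp [π₀, e₀]⟩
    rw [LinearMap.range_eq_top.2 h3, finrank_top, Module.finrank_self,
      finrank_euclideanSpace_fin] at h2
    omega
  let J : LinearMap.ker D.toLinearMap ≃L[ℝ] LinearMap.ker π₀.toLinearMap :=
    ContinuousLinearEquiv.ofFinrankEq hfin
  let R : V →L[ℝ] EuclideanSpace ℝ (Fin d) := (LinearMap.ker π₀.toLinearMap).subtypeL.comp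
    ((J : _ →L[ℝ] _).comp (LinearMap.ker D.toLinearMap).orthogonalProjectionOnto)
  have hR0 : ∀ v, R v 0 = 0 := fun v => (J ((LinearMap.ker D.toLinearMap).orthogonalProjectionOnto v)).2
  let h : V → EuclideanSpace ℝ (Fin d) × F := fun x => (s x • e₀ + R x, G x)
  have hh : ContDiff ℝ ∞ h := ((hs.smul contDiff_const).add R.contDiff).prodMk hG
  let L : V →L[ℝ] EuclideanSpace ℝ (Fin d) × F := ((fderiv ℝ s p).smulRight e₀ + R).prod (fderiv ℝ G p)
  have hL : HasFDerivAt h L p :=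
    (((hs.differentiable (by simp) p).hasFDerivAt.smul_const e₀).add R.hasFDerivAt).prodMk
      (hG.differentiable (by simp) p).hasFDerivAt
  have hLinj : Function.Injective L.toLinearMap := by
    rw [← LinearMap.ker_eq_bot, LinearMap.ker_eq_bot']
    intro v hv
    have hv1 : fderiv ℝ s p v • e₀ + R v = 0 := congrArg Prod.fst hv
    have hv2 : fderiv ℝ G p v = 0 := congrArg Prod.snd hv
    have hv3 : fderiv ℝ s p v = 0 := by
      have := congrArg (fun z : EuclideanSpace ℝ (Fin d) => z 0) hv1
      simpa [e₀, hR0] using this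
    have hvK : v ∈ LinearMap.ker D.toLinearMap := by
      change D v = 0
      rw [hD, ContinuousLinearMap.prod_apply, hv2, hv3]; rfl
    rw [hv3, zero_smul, zero_add] at hv1
    have h4 : J ((LinearMap.ker D.toLinearMap).orthogonalProjectionOnto v) = 0 := Subtype.ext hv1
    rw [J.map_eq_zero_iff] at h4
    have h5 := Submodule.orthogonalProjectionOnto_mem_subspace_eq_self
      (K := LinearMap.ker D.toLinearMap) ⟨v, hvK⟩
    rw [h4] at h5
    exact (congrArg Subtype.val h5).symm
  let A : V ≃L[ℝ] EuclideanSpace ℝ (Fin d) × F := (LinearEquiv.ofInjectiveOfFinrankEq L.toLinearMap hLinj (by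
    rw [Module.finrank_prod, finrank_euclideanSpace_fin, hd])).toContinuousLinearEquiv
  have hA : fderiv ℝ h p = A := by
    rw [hL.fderiv]; ext v <;> rfl
  obtain ⟨e, he, hpe, heU, hes⟩ := exists_openPartialHomeomorph_contDiffOn hh p A hA hU hp
  have h0 : ∀ x, (h x).1 0 = s x := fun x => by simp [h, e₀, hR0]
  refine ⟨⟨e, hpe, ?_, hes, fun x hx => ?_, fun x hx hxM => ?_⟩⟩
  · rw [he]; exact hh.contDiffOn
  · rw [hM x (heU hx), he, h0]
  · rw [hB x (heU hx) hxM, he, h0]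

/-- A regular level set, cut by a regular superlevel set, is a submanifold with boundary. -/
theorem isSmoothSubmanifoldWithBoundary_of_regular {d : ℕ} [NeZero d]
    (hd : Module.finrank ℝ V = d + Module.finrank ℝ F) {G : V → F} {s : V → ℝ}
    (hG : ContDiff ℝ ∞ G) (hs : ContDiff ℝ ∞ s)
    (hreg : ∀ p, G p = 0 → 0 < s p → Function.Surjective (fderiv ℝ G p))
    (hreg' : ∀ p, G p = 0 → s p = 0 →
      Function.Surjective ((fderiv ℝ s p).prod (fderiv ℝ G p))) :
    IsSmoothSubmanifoldWithBoundary d {x | 0 ≤ s x ∧ G x = 0} {x | s x = 0 ∧ G x = 0} := by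
  refine isSmoothSubmanifoldWithBoundary_of_straightening (F := F) (fun x hx => ⟨hx.1.ge, hx.2⟩)
    hd ?_
  rintro p ⟨hp, hpG⟩
  rcases hp.eq_or_lt with hp | hp
  · exact nonempty_boundaryStraightening hd hG hs isOpen_univ (Set.mem_univ p) (fun x _ => Iff.rfl)
      (fun x _ hx => ⟨fun h => h.1, fun h => ⟨h, hx.2⟩⟩) (hreg' p hpG hp.symm)
  · have hsurj := hreg p hpG hp
    obtain ⟨v, hv, hv0⟩ : ∃ v, fderiv ℝ G p v = 0 ∧ v ≠ 0 := by
      have h1 := (fderiv ℝ G p).toLinearMap.finrank_range_add_finrank_ker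
      rw [LinearMap.range_eq_top.2 hsurj, finrank_top] at h1
      have h2 : 0 < Module.finrank ℝ (LinearMap.ker (fderiv ℝ G p).toLinearMap) := by
        have := NeZero.pos d
        omega
      have := Module.finrank_pos_iff.1 h2
      obtain ⟨v, hv⟩ := exists_ne (0 : LinearMap.ker (fderiv ℝ G p).toLinearMap)
      exact ⟨v, v.2, fun h => hv (Subtype.ext h)⟩
    -- At an interior point `s` may have a critical point on the level set. It is replaced by an
    -- affine function, positive near `p`, whose gradient `v` lies in the kernel of `fderiv ℝ G p`,
    -- so that the joint differential is onto.
    let t : V → ℝ := fun x => 1 + innerSL ℝ v (x - p)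
    have ht : ContDiff ℝ ∞ t :=
      contDiff_const.add ((innerSL ℝ v).contDiff.comp (contDiff_id.sub contDiff_const))
    have htd : fderiv ℝ t p = innerSL ℝ v := by
      have : HasFDerivAt t ((innerSL ℝ v).comp (ContinuousLinearMap.id ℝ V)) p :=
        ((innerSL ℝ v).hasFDerivAt.comp p ((hasFDerivAt_id p).sub_const p)).const_add 1
      rw [this.fderiv, ContinuousLinearMap.comp_id]
    have hU : IsOpen ({x | 0 < s x} ∩ {x | 0 < t x}) :=
      (isOpen_lt continuous_const hs.continuous).inter (isOpen_lt continuous_const ht.continuous)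
    refine nonempty_boundaryStraightening hd hG ht hU ⟨hp, by simp [t]⟩ ?_ ?_ ?_
    · rintro x ⟨hx1, hx2⟩
      exact ⟨fun h => ⟨le_of_lt hx2, h.2⟩, fun h => ⟨le_of_lt hx1, h.2⟩⟩
    · rintro x ⟨hx1, hx2⟩ -
      exact ⟨fun h => absurd h.1 (ne_of_gt hx1), fun h => absurd h (ne_of_gt hx2)⟩
    · rintro ⟨c, y⟩
      obtain ⟨w, hw⟩ := hsurj y
      have hvv : inner ℝ v v ≠ (0 : ℝ) := inner_self_ne_zero.2 hv0
      refine ⟨w + ((c - inner ℝ v w) / inner ℝ v v) • v, Prod.ext ?_ ?_⟩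
      · rw [htd]
        simp only [ContinuousLinearMap.prod_apply, innerSL_apply_apply, inner_add_right, inner_smul_right]
        field_simp
        ring
      · simp [hv, hw]

/-- Every vector in the kernel of the differential of a submersion is the velocity of a smooth
curve in the level set. -/
lemma exists_curve_of_submersion {G : V → F} (hG : ContDiff ℝ ∞ G) {p v : V} (hp : G p = 0)
    (hsurj : Function.Surjective (fderiv ℝ G p)) (hv : fderiv ℝ G p v = 0) :
    ∃ γ : ℝ → V, ContDiffAt ℝ ∞ γ 0 ∧ γ 0 = p ∧ (∀ᶠ t in 𝓝 (0 : ℝ), G (γ t) = 0) ∧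
      HasDerivAt γ v 0 := by
  set D := fderiv ℝ G p with hD
  let K := LinearMap.ker D.toLinearMap
  let h : V → F × K := fun x => (G x, K.orthogonalProjectionOnto x)
  have hh : ContDiff ℝ ∞ h := hG.prodMk K.orthogonalProjectionOnto.contDiff
  let L : V →L[ℝ] F × K := D.prod K.orthogonalProjectionOnto
  have hL : HasFDerivAt h L p :=
    (hG.differentiable (by simp) p).hasFDerivAt.prodMk K.orthogonalProjectionOnto.hasFDerivAt
  have hLinj : Function.Injective L.toLinearMap := by
    rw [← LinearMap.ker_eq_bot, LinearMap.ker_eq_bot']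
    intro v hv
    have hv1 : v ∈ K := congrArg Prod.fst hv
    have hv2 : K.orthogonalProjectionOnto v = 0 := congrArg Prod.snd hv
    have h5 := Submodule.orthogonalProjectionOnto_mem_subspace_eq_self (K := K) ⟨v, hv1⟩
    rw [hv2] at h5
    exact (congrArg Subtype.val h5).symm
  have hfin : Module.finrank ℝ V = Module.finrank ℝ (F × K) := by
    have h1 := D.toLinearMap.finrank_range_add_finrank_ker
    rw [LinearMap.range_eq_top.2 hsurj, finrank_top] at h1
    rw [Module.finrank_prod, h1]
  let A : V ≃L[ℝ] F × K :=
    (LinearEquiv.ofInjectiveOfFinrankEq L.toLinearMap hLinj hfin).toContinuousLinearEquiv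
  have hA : fderiv ℝ h p = A := by rw [hL.fderiv]; ext v <;> rfl
  obtain ⟨e, he, hpe, -, hes⟩ :=
    exists_openPartialHomeomorph_contDiffOn hh p A hA isOpen_univ (Set.mem_univ p)
  -- The curve is the preimage of a straight line in the coordinates `(G, projection to K)`. The
  -- `F`-component of `A v` vanishes, so `G` is constant along it.
  let ℓ : ℝ → F × K := fun t => e p + t • A v
  have hℓ : ContDiff ℝ ∞ ℓ := contDiff_const.add (contDiff_id.smul contDiff_const)
  have hℓ0 : ℓ 0 = e p := by simp [ℓ]
  have hℓd : HasDerivAt ℓ (A v) 0 := by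
    simpa only [one_smul] using! ((hasDerivAt_id (0 : ℝ)).smul_const (A v)).const_add (e p)
  have htgt : e p ∈ e.target := e.map_source hpe
  have hsm : ContDiffAt ℝ ∞ e.symm (ℓ 0) := by
    rw [hℓ0]; exact hes.contDiffAt (e.open_target.mem_nhds htgt)
  refine ⟨fun t => e.symm (ℓ t), hsm.comp 0 hℓ.contDiffAt, ?_, ?_, ?_⟩
  · change e.symm (ℓ 0) = p
    rw [hℓ0, e.left_inv hpe]
  · have : ∀ᶠ t in 𝓝 (0 : ℝ), ℓ t ∈ e.target :=
      hℓ.continuous.continuousAt.eventually_mem (by rw [hℓ0]; exact e.open_target.mem_nhds htgt)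
    filter_upwards [this] with t ht
    have h1 : h (e.symm (ℓ t)) = ℓ t := by rw [← he]; exact e.right_inv ht
    have h2 : G (e.symm (ℓ t)) = (ℓ t).1 := congrArg Prod.fst h1
    have h3 : (A v).1 = 0 := hv
    rw [h2]
    simp [ℓ, h3, he, h, hp]
  · have hd : HasFDerivAt e.symm (A.symm : F × K →L[ℝ] V) (ℓ 0) := by
      rw [hℓ0]
      refine e.hasFDerivAt_symm htgt ?_
      rw [e.left_inv hpe, he, ← hA]
      exact (hh.differentiable (by simp) p).hasFDerivAt
    have := hd.comp_hasDerivAt (0 : ℝ) hℓd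
    rwa [ContinuousLinearEquiv.coe_coe, A.symm_apply_apply] at this

end RegularSets

/-! ### A global smooth defining function of the hypersurface. -/

section DefiningFunction

lemma eventually_pos_of_hasDerivAt_pos {g : ℝ → ℝ} {g' : ℝ} (hg : HasDerivAt g g' 0) (h0 : g 0 = 0)
    (hg' : 0 < g') : ∀ᶠ t in 𝓝[>] (0 : ℝ), 0 < g t := by
  have h1 : ∀ᶠ t in 𝓝[≠] (0 : ℝ), 0 < slope g 0 t :=
    (hasDerivAt_iff_tendsto_slope.1 hg).eventually (lt_mem_nhds hg')
  have h2 : ∀ᶠ t in 𝓝[>] (0 : ℝ), 0 < slope g 0 t :=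
    h1.filter_mono (nhdsWithin_mono _ fun t ht => ne_of_gt ht)
  filter_upwards [h2, self_mem_nhdsWithin] with t ht ht0
  rw [slope_def_field, h0, sub_zero, sub_zero] at ht
  exact (div_pos_iff_of_pos_right ht0).1 ht

variable {E : Type*} [NormedAddCommGroup E] [InnerProductSpace ℝ E]

lemma hasDerivAt_add_smul (c v : E) (τ : ℝ) : HasDerivAt (fun t : ℝ => c + t • v) v τ := by
  simpa only [one_smul] using! ((hasDerivAt_id τ).smul_const v).const_add c

/-- The Minkowski functional of `K` based at `c`. It need not be smooth; it serves as a yardstick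
for gluing local smooth defining functions. -/
lemma exists_gauge {K : Set E} (hK : Convex ℝ K) {c : E} (hc : c ∈ interior K) :
    ∃ ρ : E → ℝ, Continuous ρ ∧ (∀ x, ρ x < 1 ↔ x ∈ interior K) ∧ (∀ x, ρ x = 1 ↔ x ∈ frontier K) ∧
      (∀ x, 0 ≤ ρ x) ∧ ∀ (t : ℝ) (x : E), 0 ≤ t → ρ (c + t • (x - c)) = t * ρ x := by
  let e := Homeomorph.addRight c
  have hK' : Convex ℝ (e ⁻¹' K) := hK.translate_preimage_left c
  have h0 : e ⁻¹' K ∈ 𝓝 (0 : E) := by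
    refine e.continuous.continuousAt.preimage_mem_nhds ?_
    simpa [e] using mem_interior_iff_mem_nhds.1 hc
  refine ⟨fun x => gauge (e ⁻¹' K) (x - c), ?_, fun x => ?_, fun x => ?_, fun x => gauge_nonneg _,
    fun t x ht => ?_⟩
  · exact (continuous_gauge hK' h0).comp (continuous_id.sub continuous_const)
  · rw [gauge_lt_one_iff_mem_interior hK' h0, ← e.preimage_interior]
    simp [e]
  · rw [gauge_eq_one_iff_mem_frontier hK' h0, ← e.preimage_frontier]
    simp [e]
  · simp only
    rw [add_sub_cancel_left, gauge_smul_of_nonneg ht, smul_eq_mul]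

/-- Rays from an interior point are transversal to the frontier. Otherwise tilting the inward radial
direction by `± δ • w` would give two directions from `p` into the interior, along which `f` starts
with opposite signs. On a segment joining interior points near `p`, `f` would then vanish, and its
zeros in `U` lie on the frontier. -/
lemma fderiv_radial_ne_zero {K : Set E} (hK : Convex ℝ K) {c p : E} (hc : c ∈ interior K)
    (hp : p ∈ frontier K) {U : Set E} {f : E → ℝ} (hU : IsOpen U) (hpU : p ∈ U)
    (hf : ContinuousOn f U) (hfd : DifferentiableAt ℝ f p) (hf' : fderiv ℝ f p ≠ 0)
    (hz : frontier K ∩ U = {x ∈ U | f x = 0}) : fderiv ℝ f p (p - c) ≠ 0 := by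
  intro h0
  obtain ⟨w, hw⟩ : ∃ w, 0 < fderiv ℝ f p w := by
    obtain ⟨w, hw⟩ := DFunLike.ne_iff.1 hf'
    rcases lt_or_gt_of_ne hw with hw | hw
    · exact ⟨-w, by simpa using hw⟩
    · exact ⟨w, hw⟩
  have hfp : f p = 0 := (hz.subset ⟨hp, hpU⟩).2
  have hline : ∀ v : E, HasDerivAt (fun t : ℝ => p + t • v) v 0 := fun v =>
    hasDerivAt_add_smul p v 0
  have hcont : ∀ v : E, Continuous fun t : ℝ => p + t • v := fun v => by fun_prop
  have hder : ∀ v : E, HasDerivAt (fun t : ℝ => f (p + t • v)) (fderiv ℝ f p v) 0 := by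
    intro v
    have h1 : HasFDerivAt f (fderiv ℝ f p) (p + (0 : ℝ) • v) := by simpa using hfd.hasFDerivAt
    exact h1.comp_hasDerivAt 0 (hline v)
  have hev : ∀ v : E, 0 < fderiv ℝ f p v → ∀ᶠ t in 𝓝[>] (0 : ℝ), 0 < f (p + t • v) := fun v hv =>
    eventually_pos_of_hasDerivAt_pos (hder v) (by simp [hfp]) hv
  have hev' : ∀ v : E, fderiv ℝ f p v < 0 → ∀ᶠ t in 𝓝[>] (0 : ℝ), f (p + t • v) < 0 := by
    intro v hv
    have := eventually_pos_of_hasDerivAt_pos (hder v).neg (by simp [hfp]) (neg_pos.2 hv)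
    filter_upwards [this] with t ht
    simpa using ht
  have hδ : ∀ᶠ δ in 𝓝[>] (0 : ℝ), c + δ • w ∈ interior K ∧ c - δ • w ∈ interior K := by
    refine Filter.Eventually.filter_mono nhdsWithin_le_nhds ?_
    have h1 : ContinuousAt (fun δ : ℝ => c + δ • w) 0 := by fun_prop
    have h2 : ContinuousAt (fun δ : ℝ => c - δ • w) 0 := by fun_prop
    exact (h1.eventually_mem (isOpen_interior.mem_nhds (by simpa using hc))).and
      (h2.eventually_mem (isOpen_interior.mem_nhds (by simpa using hc)))
  obtain ⟨δ, ⟨hδ1, hδ2⟩, hδ0⟩ := (hδ.and self_mem_nhdsWithin).exists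
  have hδ0 : 0 < δ := hδ0
  have hcp : fderiv ℝ f p (c - p) = 0 := by rw [← neg_sub, map_neg, h0, neg_zero]
  have hv1 : 0 < fderiv ℝ f p (c + δ • w - p) := by
    rw [add_sub_right_comm, map_add, hcp, map_smul, zero_add, smul_eq_mul]
    positivity
  have hv2 : fderiv ℝ f p (c - δ • w - p) < 0 := by
    rw [sub_right_comm, map_sub, hcp, map_smul, zero_sub, smul_eq_mul]
    have := mul_pos hδ0 hw
    linarith
  obtain ⟨r, hr, hrU⟩ := Metric.isOpen_iff.1 hU p hpU
  have hball : ∀ v : E, ∀ᶠ t in 𝓝[>] (0 : ℝ), p + t • v ∈ Metric.ball p r := fun v =>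
    Filter.Eventually.filter_mono nhdsWithin_le_nhds
      ((hcont v).continuousAt.eventually_mem (by simpa using Metric.ball_mem_nhds p hr))
  have hle : ∀ᶠ t in 𝓝[>] (0 : ℝ), t ≤ 1 :=
    Filter.Eventually.filter_mono nhdsWithin_le_nhds (eventually_le_nhds one_pos)
  obtain ⟨t, ⟨⟨⟨⟨⟨h1, h2⟩, h3⟩, h4⟩, ht1⟩, ht0⟩⟩ := ((((((hev _ hv1).and (hev' _ hv2)).and (hball _)).and
    (hball (c - δ • w - p))).and hle).and self_mem_nhdsWithin).exists
  have hpK : p ∈ closure K := frontier_subset_closure hp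
  have hint : ∀ y ∈ interior K, p + t • (y - p) ∈ interior K := fun y hy =>
    hK.add_smul_sub_mem_interior' hpK hy ⟨ht0, ht1⟩
  have hseg : segment ℝ (p + t • (c - δ • w - p)) (p + t • (c + δ • w - p)) ⊆
      interior K ∩ Metric.ball p r :=
    (hK.interior.inter (convex_ball p r)).segment_subset ⟨hint _ hδ2, h4⟩ ⟨hint _ hδ1, h3⟩
  have hsegU : segment ℝ (p + t • (c - δ • w - p)) (p + t • (c + δ • w - p)) ⊆ U := fun y hy =>
    hrU (hseg hy).2
  obtain ⟨z, hz1, hz2⟩ := (convex_segment _ _).isPreconnected.intermediate_value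
    (left_mem_segment ℝ _ _) (right_mem_segment ℝ _ _) (hf.mono hsegU) ⟨h2.le, h1.le⟩
  have hzX : z ∈ frontier K := (hz.symm.subset ⟨hsegU hz1, hz2⟩).1
  exact hzX.2 (hseg hz1).1

/-- The two inequalities force the zero set to be exactly `X` and the radial derivative to be at
least `1` there. They are also convex conditions on the value `g x`, hence survive a partition of
unity. -/
lemma exists_local_definingFunction {X : Set E} (hX : IsSmoothHypersurface X) {K : Set E}
    (hK : Convex ℝ K) (hXK : X = frontier K) {c : E} (hc : c ∈ interior K) {ρ : E → ℝ}
    (hρ : Continuous ρ) (hρX : ∀ x, ρ x = 1 ↔ x ∈ X)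
    (hρc : ∀ (t : ℝ) (x : E), 0 ≤ t → ρ (c + t • (x - c)) = t * ρ x) {p : E} (hp : p ∈ X) :
    ∃ W ∈ 𝓝 p, ∃ g : E → ℝ, ContDiffOn ℝ ∞ g W ∧ ∀ x ∈ W,
      (ρ x ≤ 1 → g x ≤ ρ x - 1) ∧ (1 ≤ ρ x → ρ x - 1 ≤ g x) := by
  obtain ⟨U, f₀, hU, hpU, hf₀, hf₀', hz₀⟩ := hX p hp
  have hne := fderiv_radial_ne_zero hK hc (hXK ▸ hp) hU hpU hf₀.continuousOn
    ((hf₀.contDiffAt (hU.mem_nhds hpU)).differentiableAt (by simp)) hf₀' (hXK ▸ hz₀)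
  obtain ⟨f, hf, hpos, hz⟩ : ∃ f : E → ℝ, ContDiffOn ℝ ∞ f U ∧ 0 < fderiv ℝ f p (p - c) ∧
      ∀ x ∈ X ∩ U, f x = 0 := by
    rcases lt_or_gt_of_ne hne with h | h
    · refine ⟨fun x => -f₀ x, hf₀.neg, ?_, fun x hx => ?_⟩
      · rw [fderiv_fun_neg]; simpa using h
      · simp [(hz₀.subset hx).2]
    · exact ⟨f₀, hf₀, h, fun x hx => (hz₀.subset hx).2⟩
  set a := fderiv ℝ f p (p - c) with ha
  have hderiv : ContinuousAt (fun x => fderiv ℝ f x (x - c)) p :=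
    ((hf.continuousOn_fderiv_of_isOpen hU (by simp)).continuousAt (hU.mem_nhds hpU)).clm_apply
      (continuousAt_id.sub continuousAt_const)
  have hnear : ∀ᶠ x in 𝓝 p, a / 2 < fderiv ℝ f x (x - c) ∧ x ∈ U :=
    (hderiv.eventually (lt_mem_nhds (by linarith))).and (hU.mem_nhds hpU)
  obtain ⟨r, hr, hball⟩ := Metric.eventually_nhds_iff_ball.1 hnear
  have hρp : ρ p = 1 := (hρX p).2 hp
  have hproj : ContinuousAt (fun x => c + (ρ x)⁻¹ • (x - c)) p :=
    continuousAt_const.add ((hρ.continuousAt.inv₀ (by simp [hρp])).smul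
      (continuousAt_id.sub continuousAt_const))
  have hW : ∀ᶠ x in 𝓝 p, x ∈ Metric.ball p r ∧ c + (ρ x)⁻¹ • (x - c) ∈ Metric.ball p r ∧
      1 / 2 < ρ x ∧ ρ x < 2 := by
    refine Filter.Eventually.and (Metric.ball_mem_nhds p hr) ((hproj.eventually_mem ?_).and
      ((hρ.continuousAt.eventually (lt_mem_nhds ?_)).and
        (hρ.continuousAt.eventually (gt_mem_nhds ?_))))
    · simpa [hρp] using Metric.ball_mem_nhds p hr
    · rw [hρp]; norm_num
    · rw [hρp]; norm_num
  -- On the segment from the radial projection of `x` to `x` the radial parameter `τ` is at most `2`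
  -- and `τ * deriv φ τ > a / 2`, so the slope of `φ` is at least `a / 4`. The factor `8 / a` makes
  -- this `2`, and `2 * |1 - 1 / ρ| ≥ |ρ - 1|` for `ρ ≤ 2`.
  refine ⟨_, hW, fun x => 8 / a * f x, ?_, ?_⟩
  · exact contDiffOn_const.mul (hf.mono fun x hx => (hball x hx.1).2)
  rintro x ⟨hx1, hx2, hx3, hx4⟩
  have hρ0 : 0 < ρ x := by linarith
  have hxX : c + (ρ x)⁻¹ • (x - c) ∈ X := by
    rw [← hρX, hρc _ _ (inv_nonneg.2 hρ0.le), inv_mul_cancel₀ hρ0.ne']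
  have hfx : f (c + (ρ x)⁻¹ • (x - c)) = 0 := hz _ ⟨hxX, (hball _ hx2).2⟩
  let φ : ℝ → ℝ := fun τ => f (c + τ • (x - c))
  have hφ1 : φ 1 = f x := by simp [φ]
  have hmem : ∀ τ ∈ Set.uIcc (ρ x)⁻¹ 1, c + τ • (x - c) ∈ Metric.ball p r := by
    intro τ hτ
    have h1 : Convex ℝ ((fun τ : ℝ => c + τ • (x - c)) ⁻¹' Metric.ball p r) := by
      have := (convex_ball p r).affine_preimage (AffineMap.lineMap c x : ℝ →ᵃ[ℝ] E)
      have h2 : (fun τ : ℝ => c + τ • (x - c)) = AffineMap.lineMap c x := by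
        ext τ
        rw [AffineMap.lineMap_apply_module', add_comm]
      rw [h2]
      exact this
    have h2 := h1.segment_subset (x := (ρ x)⁻¹) (y := 1) hx2 (by simpa using hx1)
    rw [segment_eq_uIcc] at h2
    exact h2 hτ
  have hφd : ∀ τ ∈ Set.uIcc (ρ x)⁻¹ 1,
      HasDerivAt φ (fderiv ℝ f (c + τ • (x - c)) (x - c)) τ := by
    intro τ hτ
    have h1 : HasDerivAt (fun τ : ℝ => c + τ • (x - c)) (x - c) τ :=
      hasDerivAt_add_smul c (x - c) τ
    exact ((hf.contDiffAt (hU.mem_nhds (hball _ (hmem τ hτ)).2)).differentiableAt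
      (by simp)).hasFDerivAt.comp_hasDerivAt τ h1
  have hbound : ∀ τ ∈ Set.uIcc (ρ x)⁻¹ 1, a / 4 ≤ deriv φ τ := by
    intro τ hτ
    rw [(hφd τ hτ).deriv]
    have h1 := (hball _ (hmem τ hτ)).1
    rw [add_sub_cancel_left, map_smul, smul_eq_mul] at h1
    have hinv1 : (ρ x)⁻¹ ≤ 2 := by
      rw [inv_le_comm₀ hρ0 two_pos]; linarith
    have hτ2 : τ ≤ 2 := hτ.2.trans (max_le hinv1 one_le_two)
    have hτ0 : 0 < τ := lt_of_lt_of_le (lt_min (inv_pos.2 hρ0) one_pos) hτ.1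
    have h2 : 0 < fderiv ℝ f (c + τ • (x - c)) (x - c) := by
      by_contra! hcon
      have := mul_nonpos_of_nonneg_of_nonpos hτ0.le hcon
      linarith
    nlinarith
  have hmvt := (convex_uIcc (ρ x)⁻¹ 1).mul_sub_le_image_sub_of_le_deriv
    (fun τ hτ => (hφd τ hτ).continuousAt.continuousWithinAt)
    (fun τ hτ => (hφd τ (interior_subset hτ)).differentiableAt.differentiableWithinAt)
    (fun τ hτ => hbound τ (interior_subset hτ))
  have hinv : ρ x * (ρ x)⁻¹ = 1 := mul_inv_cancel₀ hρ0.ne'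
  have hφ0 : φ (ρ x)⁻¹ = 0 := hfx
  have e1 : 8 / a * (a / 4) = 2 := by field_simp; norm_num
  have hpos8 : 0 < 8 / a := by positivity
  constructor
  · intro h
    have h1 := hmvt 1 Set.right_mem_uIcc (ρ x)⁻¹ Set.left_mem_uIcc ((one_le_inv₀ hρ0).2 h)
    rw [hφ0, hφ1] at h1
    have h2 := mul_le_mul_of_nonneg_left h1 hpos8.le
    rw [← mul_assoc, e1] at h2
    have h3 : 1 - ρ x ≤ (ρ x)⁻¹ - 1 := by nlinarith [sq_nonneg (ρ x - 1), inv_pos.2 hρ0]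
    linarith
  · intro h
    have h1 := hmvt (ρ x)⁻¹ Set.left_mem_uIcc 1 Set.right_mem_uIcc (inv_le_one_of_one_le₀ h)
    rw [hφ0, hφ1] at h1
    have h2 := mul_le_mul_of_nonneg_left h1 hpos8.le
    rw [← mul_assoc, e1] at h2
    have h3 : ρ x - 1 ≤ 2 * (1 - (ρ x)⁻¹) := by
      have : (ρ x)⁻¹ ≤ 1 := inv_le_one_of_one_le₀ h
      nlinarith
    linarith

/-- A closed strictly convex hypersurface is the regular zero set of a smooth function that is
negative inside the table. -/
theorem exists_definingFunction [FiniteDimensional ℝ E] {X K : Set E} (hX : IsSmoothHypersurface X)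
    (hK : Convex ℝ K) (hKi : (interior K).Nonempty) (hXK : X = frontier K) :
    ∃ f : E → ℝ, ContDiff ℝ ∞ f ∧ (∀ x, f x = 0 ↔ x ∈ X) ∧ (∀ x ∈ interior K, f x < 0) ∧
      ∀ x ∈ X, fderiv ℝ f x ≠ 0 := by
  obtain ⟨c, hc⟩ := hKi
  obtain ⟨ρ, hρ, hρi, hρX, hρ0, hρc⟩ := exists_gauge hK hc
  rw [← hXK] at hρX
  let t : E → Set ℝ := fun x => {y | (ρ x ≤ 1 → y ≤ ρ x - 1) ∧ (1 ≤ ρ x → ρ x - 1 ≤ y)}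
  have ht : ∀ x, Convex ℝ (t x) := by
    intro x
    have h1 : Convex ℝ {y : ℝ | ρ x ≤ 1 → y ≤ ρ x - 1} := by
      by_cases h : ρ x ≤ 1
      · simpa only [h, true_imp_iff] using! convex_Iic (𝕜 := ℝ) (ρ x - 1)
      · simpa [h] using convex_univ
    have h2 : Convex ℝ {y : ℝ | 1 ≤ ρ x → ρ x - 1 ≤ y} := by
      by_cases h : 1 ≤ ρ x
      · simpa only [h, true_imp_iff] using! convex_Ici (𝕜 := ℝ) (ρ x - 1)
      · simpa [h] using convex_univ
    exact h1.inter h2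
  obtain ⟨f, hf⟩ := exists_contMDiffMap_forall_mem_convex_of_local (n := ⊤) 𝓘(ℝ, E) ht (by
    intro p
    rcases lt_trichotomy (ρ p) 1 with h | h | h
    · refine ⟨{x | ρ x < 1}, (isOpen_lt hρ continuous_const).mem_nhds h, fun _ => -1,
        contMDiffOn_const, fun x hx => ⟨fun _ => ?_, fun h' => ?_⟩⟩
      · have := hρ0 x
        linarith
      · have : ρ x < 1 := hx
        linarith
    · obtain ⟨W, hW, g, hg, hgt⟩ := exists_local_definingFunction hX hK hXK hc hρ hρX hρc
        ((hρX p).1 h)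
      exact ⟨W, hW, g, contMDiffOn_iff_contDiffOn.2 hg, hgt⟩
    · refine ⟨{x | 1 < ρ x} ∩ {x | ρ x < ρ p + 1}, ((isOpen_lt continuous_const hρ).inter
        (isOpen_lt hρ continuous_const)).mem_nhds ⟨h, by simp⟩, fun _ => ρ p,
        contMDiffOn_const, fun x hx => ⟨fun h' => ?_, fun _ => ?_⟩⟩
      · have : 1 < ρ x := hx.1
        linarith
      · have : ρ x < ρ p + 1 := hx.2
        linarith)
  have hfs : ContDiff ℝ ∞ f := f.contMDiff.contDiff
  have hzero : ∀ x, f x = 0 ↔ x ∈ X := by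
    intro x
    rw [← hρX]
    have h1 := hf x
    refine ⟨fun h0 => ?_, fun h => le_antisymm ?_ ?_⟩
    · rcases lt_trichotomy (ρ x) 1 with h | h | h
      · have := h1.1 h.le; linarith
      · exact h
      · have := h1.2 h.le; linarith
    · have := h1.1 h.le; linarith
    · have := h1.2 h.ge; linarith
  refine ⟨f, hfs, hzero, fun x hx => ?_, fun p hp h0 => ?_⟩
  · have h1 := (hρi x).2 hx
    have := (hf x).1 h1.le
    linarith
  -- Along the outward ray `ρ` equals `1 + t`, so `f ≥ t` for `t ≥ 0`. With zero differential, `f`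
  -- would be smaller than `t / 2` for small `t > 0`.
  · have hline : HasDerivAt (fun t : ℝ => p + t • (p - c)) (p - c) 0 :=
      hasDerivAt_add_smul p (p - c) 0
    have h1 : HasFDerivAt f (0 : E →L[ℝ] ℝ) (p + (0 : ℝ) • (p - c)) := by
      rw [zero_smul, add_zero, ← h0]
      exact (hfs.differentiable (by simp) p).hasFDerivAt
    have h1' : HasDerivAt (fun t : ℝ => f (p + t • (p - c))) 0 0 := by
      simpa only [zero_apply] using! h1.comp_hasDerivAt (0 : ℝ) hline
    have h2 : HasDerivAt (fun t : ℝ => t / 2 - f (p + t • (p - c))) (1 / 2 - 0) 0 :=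
      ((hasDerivAt_id (0 : ℝ)).div_const 2).sub h1'
    have h3 := eventually_pos_of_hasDerivAt_pos h2 (by simp [(hzero p).2 hp]) (by norm_num)
    obtain ⟨t, ht, ht0⟩ := (h3.and self_mem_nhdsWithin).exists
    have ht0 : 0 < t := ht0
    have h4 : ρ (p + t • (p - c)) = 1 + t := by
      have : p + t • (p - c) = c + (1 + t) • (p - c) := by rw [add_smul, one_smul]; abel
      rw [this, hρc _ _ (by positivity), (hρX p).2 hp, mul_one]
    have h5 := (hf (p + t • (p - c))).2 (by rw [h4]; linarith)
    rw [h4] at h5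
    linarith

end DefiningFunction

/-! ### The local estimate at a vertex, and positivity of the sum around the polygon. -/

section Vertex

variable {E : Type*} [NormedAddCommGroup E] [InnerProductSpace ℝ E]

/-- The unit vector in the direction from `x` to `y`. -/
def sideUnit (x y : E) : E := (dist x y)⁻¹ • (y - x)

lemma norm_sideUnit {x y : E} (h : x ≠ y) : ‖sideUnit x y‖ = 1 := by
  rw [sideUnit, norm_smul, norm_inv, Real.norm_of_nonneg dist_nonneg, dist_eq_norm', inv_mul_cancel₀]
  exact norm_ne_zero_iff.2 (sub_ne_zero.2 h.symm)

lemma dist_smul_sideUnit (x y : E) : dist x y • sideUnit x y = y - x := by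
  by_cases h : x = y
  · simp [h]
  · rw [sideUnit, smul_smul, mul_inv_cancel₀ (dist_ne_zero.2 h), one_smul]

/-- The contribution of the vertex `y`, with neighbours `x` and `z`, to the scalar product of the
tangential gradients of the perimeter and of the logarithm of the product of the sides. -/
def vertexForm (ν : E) (x y z : E) : ℝ :=
  (1 - inner ℝ ν (sideUnit x y) ^ 2) * (dist x y)⁻¹ +
    (1 - inner ℝ ν (sideUnit y z) ^ 2) * (dist y z)⁻¹ -
    (inner ℝ (sideUnit x y) (sideUnit y z) -
      inner ℝ ν (sideUnit x y) * inner ℝ ν (sideUnit y z)) * ((dist x y)⁻¹ + (dist y z)⁻¹)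

/-- The product is negative only if the factors have opposite signs. If, say, `A ≤ B` and `B * t ≤ A
* s`, its absolute value is at most `(1 - A) * s ≤ (1 - A ^ 2) * s`. -/
lemma neg_le_sub_mul_sub {A B s t C : ℝ} (hA0 : 0 ≤ A) (hA : A ≤ 1) (hB0 : 0 ≤ B) (hB : B ≤ 1)
    (hs : 0 ≤ s) (ht : 0 ≤ t) (hC : 0 ≤ C) (h1 : (1 - A ^ 2) * s ≤ C) (h2 : (1 - B ^ 2) * t ≤ C) :
    -C ≤ (A - B) * (A * s - B * t) := by
  have hAs : A * s ≤ s := mul_le_of_le_one_left hs hA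
  have hBt : B * t ≤ t := mul_le_of_le_one_left ht hB
  have hAs0 := mul_nonneg hA0 hs
  have hBt0 := mul_nonneg hB0 ht
  have h1' : (1 - A) * s ≤ C := le_trans (mul_le_mul_of_nonneg_right (by nlinarith) hs) h1
  have h2' : (1 - B) * t ≤ C := le_trans (mul_le_mul_of_nonneg_right (by nlinarith) ht) h2
  rcases le_total A B with h | h <;> rcases le_total (A * s) (B * t) with h' | h'
  · have := mul_nonneg_of_nonpos_of_nonpos (sub_nonpos.2 h) (sub_nonpos.2 h')
    linarith
  · have : (B - A) * (A * s - B * t) ≤ (1 - A) * s :=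
      mul_le_mul (by linarith) (by linarith) (by linarith) (by linarith)
    linarith
  · have : (A - B) * (B * t - A * s) ≤ (1 - B) * t :=
      mul_le_mul (by linarith) (by linarith) (by linarith) (by linarith)
    linarith
  · have := mul_nonneg (sub_nonneg.2 h) (sub_nonneg.2 h')
    linarith

/-- Cauchy–Schwarz for the components of `u` and `v` orthogonal to `ν`. -/
lemma inner_sub_le_of_norm_eq_one {ν u v : E} (hν : ‖ν‖ = 1) (hu : ‖u‖ = 1) (hv : ‖v‖ = 1) :
    inner ℝ u v - inner ℝ ν u * inner ℝ ν v ≤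
      √(1 - inner ℝ ν u ^ 2) * √(1 - inner ℝ ν v ^ 2) := by
  have hνν : inner ℝ ν ν = (1 : ℝ) := by rw [real_inner_self_eq_norm_sq, hν, one_pow]
  have key : ∀ w : E, ‖w‖ = 1 → ‖w - inner ℝ ν w • ν‖ = √(1 - inner ℝ ν w ^ 2) := by
    intro w hw
    rw [eq_comm, Real.sqrt_eq_iff_eq_sq _ (norm_nonneg _)]
    · rw [norm_sub_sq_real, real_inner_smul_right, norm_smul, hν, hw, real_inner_comm ν w, mul_one,
        Real.norm_eq_abs, sq_abs]
      ring
    · have := abs_real_inner_le_norm ν w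
      rw [hν, hw, one_mul] at this
      nlinarith [sq_abs (inner ℝ ν w), abs_nonneg (inner ℝ ν w)]
  rw [← key u hu, ← key v hv]
  refine le_trans (le_of_eq ?_) (real_inner_le_norm _ _)
  rw [inner_sub_left, inner_sub_right, inner_sub_right, real_inner_smul_left, real_inner_smul_left,
    real_inner_smul_right, real_inner_smul_right, hνν, real_inner_comm ν u]
  ring

variable {X : Set E} {ν : E → E} {C : ℝ}

/-- The field `ν` is a unit normal field of a set `X` whose chords from a point deviate at most
quadratically from the tangent space, and that has no tangent chords (uniformly). -/
structure IsStrictNormalField (X : Set E) (ν : E → E) (C : ℝ) : Prop where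
  norm_eq : ∀ y ∈ X, ‖ν y‖ = 1
  nonneg : 0 ≤ C
  inner_le : ∀ y ∈ X, ∀ x ∈ X, |inner ℝ (ν y) (x - y)| ≤ C * dist x y ^ 2
  le_inner : ∀ δ > 0, ∃ η > 0, ∀ y ∈ X, ∀ x ∈ X, δ ≤ dist x y →
    η * dist x y ≤ |inner ℝ (ν y) (x - y)|

namespace IsStrictNormalField

lemma abs_inner_sideUnit_le (h : IsStrictNormalField X ν C) {x y : E} (hx : x ∈ X) (hy : y ∈ X)
    (hxy : x ≠ y) : |inner ℝ (ν y) (sideUnit x y)| ≤ C * dist x y := by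
  have h1 := h.inner_le y hy x hx
  have hd : 0 < dist x y := dist_pos.2 hxy
  rw [← neg_sub, inner_neg_right, abs_neg, ← dist_smul_sideUnit, real_inner_smul_right, abs_mul,
    abs_of_pos hd] at h1
  nlinarith

lemma abs_inner_sideUnit_le' (h : IsStrictNormalField X ν C) {y z : E} (hy : y ∈ X) (hz : z ∈ X)
    (hyz : y ≠ z) : |inner ℝ (ν y) (sideUnit y z)| ≤ C * dist y z := by
  have h1 := h.inner_le y hy z hz
  have hd : 0 < dist y z := dist_pos.2 hyz
  rw [← dist_smul_sideUnit, real_inner_smul_right, abs_mul, abs_of_pos hd, dist_comm z y] at h1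
  nlinarith

lemma abs_inner_sideUnit_le_one (h : IsStrictNormalField X ν C) {x y w : E} (hw : w ∈ X)
    (hxy : x ≠ y) : |inner ℝ (ν w) (sideUnit x y)| ≤ 1 := by
  have := abs_real_inner_le_norm (ν w) (sideUnit x y)
  rwa [h.norm_eq w hw, norm_sideUnit hxy, one_mul] at this

/-- `A` and `B` are the lengths of the tangential parts of the two unit sides. The decomposition
isolates a term bounded below by `-C` from a nonnegative Cauchy–Schwarz defect. The bound uses `1 -
A ^ 2 = α ^ 2 ≤ |α| ≤ C * dist x y`, and likewise for `B`. -/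
lemma exists_sqrt (h : IsStrictNormalField X ν C) {x y z : E} (hx : x ∈ X) (hy : y ∈ X)
    (hz : z ∈ X) (hxy : x ≠ y) (hyz : y ≠ z) :
    ∃ A B : ℝ, 0 ≤ A ∧ A ≤ 1 ∧ 0 ≤ B ∧ B ≤ 1 ∧
      A ^ 2 = 1 - inner ℝ (ν y) (sideUnit x y) ^ 2 ∧ B ^ 2 = 1 - inner ℝ (ν y) (sideUnit y z) ^ 2 ∧
      inner ℝ (sideUnit x y) (sideUnit y z) -
        inner ℝ (ν y) (sideUnit x y) * inner ℝ (ν y) (sideUnit y z) ≤ A * B ∧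
      vertexForm (ν y) x y z = (A - B) * (A * (dist x y)⁻¹ - B * (dist y z)⁻¹) +
        (A * B - (inner ℝ (sideUnit x y) (sideUnit y z) -
          inner ℝ (ν y) (sideUnit x y) * inner ℝ (ν y) (sideUnit y z))) *
            ((dist x y)⁻¹ + (dist y z)⁻¹) ∧
      -C ≤ (A - B) * (A * (dist x y)⁻¹ - B * (dist y z)⁻¹) := by
  set α := inner ℝ (ν y) (sideUnit x y) with hα
  set β := inner ℝ (ν y) (sideUnit y z) with hβ
  have h1 : |α| ≤ 1 := h.abs_inner_sideUnit_le_one hy hxy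
  have h2 : |β| ≤ 1 := h.abs_inner_sideUnit_le_one hy hyz
  have h3 : |α| ≤ C * dist x y := h.abs_inner_sideUnit_le hx hy hxy
  have h4 : |β| ≤ C * dist y z := h.abs_inner_sideUnit_le' hy hz hyz
  have h1' : α ^ 2 ≤ |α| := by rw [← sq_abs]; nlinarith [abs_nonneg α]
  have h2' : β ^ 2 ≤ |β| := by rw [← sq_abs]; nlinarith [abs_nonneg β]
  have hA : √(1 - α ^ 2) ^ 2 = 1 - α ^ 2 := Real.sq_sqrt (by linarith)
  have hB : √(1 - β ^ 2) ^ 2 = 1 - β ^ 2 := Real.sq_sqrt (by linarith)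
  have hA1 : √(1 - α ^ 2) ≤ 1 := Real.sqrt_le_one.2 (by nlinarith)
  have hB1 : √(1 - β ^ 2) ≤ 1 := Real.sqrt_le_one.2 (by nlinarith)
  have hd1 : 0 < dist x y := dist_pos.2 hxy
  have hd2 : 0 < dist y z := dist_pos.2 hyz
  refine ⟨√(1 - α ^ 2), √(1 - β ^ 2), Real.sqrt_nonneg _, hA1, Real.sqrt_nonneg _, hB1, hA, hB,
    inner_sub_le_of_norm_eq_one (h.norm_eq y hy) (norm_sideUnit hxy) (norm_sideUnit hyz), ?_, ?_⟩
  · rw [vertexForm, ← hα, ← hβ]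
    linear_combination (-(dist x y)⁻¹) * hA - (dist y z)⁻¹ * hB
  · refine neg_le_sub_mul_sub (Real.sqrt_nonneg _) hA1 (Real.sqrt_nonneg _) hB1
      (inv_nonneg.2 hd1.le) (inv_nonneg.2 hd2.le) h.nonneg ?_ ?_
    · rw [hA, ← div_eq_mul_inv, div_le_iff₀ hd1]; linarith
    · rw [hB, ← div_eq_mul_inv, div_le_iff₀ hd2]; linarith

lemma neg_le_vertexForm (h : IsStrictNormalField X ν C) {x y z : E} (hx : x ∈ X) (hy : y ∈ X)
    (hz : z ∈ X) (hxy : x ≠ y) (hyz : y ≠ z) : -C ≤ vertexForm (ν y) x y z := by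
  obtain ⟨A, B, -, -, -, -, -, -, h1, h2, h3⟩ := h.exists_sqrt hx hy hz hxy hyz
  rw [h2]
  have : 0 ≤ (dist x y)⁻¹ + (dist y z)⁻¹ := by positivity
  have := mul_nonneg (sub_nonneg.2 h1) this
  linarith

/-- A short side followed by a long one makes the form large: `A` is near `1`, `B` stays away from
`1` because a long chord is uniformly transversal to `X`, and the factor `A / dist x y` blows up. -/
lemma exists_dist_le (h : IsStrictNormalField X ν C) {M : ℝ} (hM : 0 ≤ M) {δ : ℝ} (hδ : 0 < δ) :
    ∃ μ > 0, ∀ x ∈ X, ∀ y ∈ X, ∀ z ∈ X, x ≠ y → y ≠ z → vertexForm (ν y) x y z ≤ M →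
      dist x y ≤ μ → dist y z ≤ δ := by
  obtain ⟨η, hη, hηX⟩ := h.le_inner δ hδ
  have hC := h.nonneg
  set T := 2 / δ + 8 * (M + 1) / η ^ 2 + 2 * C / η + 2 * C + 1 with hT
  have hT0 : 0 < T := by positivity
  refine ⟨T⁻¹, inv_pos.2 hT0, fun x hx y hy z hz hxy hyz hf hd => ?_⟩
  by_contra! hlt
  obtain ⟨A, B, hA0, hA1, hB0, hB1, hA, hB, h1, h2, -⟩ := h.exists_sqrt hx hy hz hxy hyz
  set α := inner ℝ (ν y) (sideUnit x y)
  set β := inner ℝ (ν y) (sideUnit y z)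
  have hd1 : 0 < dist x y := dist_pos.2 hxy
  have hd2 : 0 < dist y z := dist_pos.2 hyz
  have hs : T ≤ (dist x y)⁻¹ := by rwa [le_inv_comm₀ hT0 hd1]
  have hα : |α| ≤ C * T⁻¹ :=
    (h.abs_inner_sideUnit_le hx hy hxy).trans (mul_le_mul_of_nonneg_left hd hC)
  have hβ : η ≤ |β| := by
    have := hηX y hy z hz (by rw [dist_comm]; exact hlt.le)
    rw [← dist_smul_sideUnit, real_inner_smul_right, abs_mul, abs_of_pos hd2, dist_comm z y,
      mul_comm] at this
    exact le_of_mul_le_mul_left this hd2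
  have p1 : 0 ≤ 2 / δ := by positivity
  have p2 : 0 ≤ 8 * (M + 1) / η ^ 2 := by positivity
  have p3 : 0 ≤ 2 * C / η := by positivity
  have hα1 : |α| ≤ η / 2 := by
    refine hα.trans ?_
    rw [← div_eq_mul_inv, div_le_iff₀ hT0]
    have h5 : 2 * C / η ≤ T := by rw [hT]; linarith
    rw [div_le_iff₀ hη] at h5
    linarith
  have hα2 : |α| ≤ 1 / 2 := by
    refine hα.trans ?_
    rw [← div_eq_mul_inv, div_le_iff₀ hT0]
    linarith
  have hα1' : α ^ 2 ≤ η ^ 2 / 4 := by rw [← sq_abs]; nlinarith [abs_nonneg α]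
  have hα2' : α ^ 2 ≤ 1 / 2 := by rw [← sq_abs]; nlinarith [abs_nonneg α]
  have hβ' : η ^ 2 ≤ β ^ 2 := by rw [← sq_abs β]; nlinarith
  have hAA : A ^ 2 ≤ A := by rw [sq]; exact mul_le_of_le_one_left hA0 hA1
  have hAlow : 1 - η ^ 2 / 4 ≤ A := by linarith
  have hAhalf : 1 / 2 ≤ A := by linarith
  have hBup : B ≤ 1 - η ^ 2 / 2 := by
    have := sq_nonneg (B - 1)
    rw [sub_sq, hB] at this
    linarith
  have ht : (dist y z)⁻¹ ≤ δ⁻¹ := inv_anti₀ hδ hlt.le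
  have h6 : T / 2 - 1 / δ ≤ A * (dist x y)⁻¹ - B * (dist y z)⁻¹ := by
    have e1 : 1 / 2 * T ≤ A * (dist x y)⁻¹ := mul_le_mul hAhalf hs hT0.le hA0
    have e2 : B * (dist y z)⁻¹ ≤ 1 * δ⁻¹ := mul_le_mul hB1 ht (by positivity) one_pos.le
    rw [one_mul] at e2
    rw [one_div]
    linarith
  have h7 : 4 * (M + 1) / η ^ 2 ≤ T / 2 - 1 / δ := by
    have e1 : 2 / δ = 2 * (1 / δ) := by ring
    have e2 : 8 * (M + 1) / η ^ 2 = 2 * (4 * (M + 1) / η ^ 2) := by ring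
    rw [hT, e1, e2]
    linarith
  have h8 : η ^ 2 / 4 * (4 * (M + 1) / η ^ 2) ≤
      (A - B) * (A * (dist x y)⁻¹ - B * (dist y z)⁻¹) :=
    mul_le_mul (by linarith) (h7.trans h6) (by positivity) (by linarith [sq_nonneg η])
  have h9 : η ^ 2 / 4 * (4 * (M + 1) / η ^ 2) = M + 1 := by field_simp
  have h10 := mul_nonneg (sub_nonneg.2 h1) (by positivity : 0 ≤ (dist x y)⁻¹ + (dist y z)⁻¹)
  linarith

/-- The defect `A * B - (g - α * β)` divided by `dist x y` is at most `M + C`, so the defect is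
small. Both sides being short, `α` and `β` are small too, and `g` is close to `1`. -/
lemma exists_norm_sub_le (h : IsStrictNormalField X ν C) {M : ℝ} (hM : 0 ≤ M) {θ : ℝ}
    (hθ : 0 < θ) :
    ∃ μ > 0, ∀ x ∈ X, ∀ y ∈ X, ∀ z ∈ X, x ≠ y → y ≠ z → vertexForm (ν y) x y z ≤ M →
      dist x y ≤ μ → dist y z ≤ θ ∧ ‖sideUnit y z - sideUnit x y‖ ≤ θ := by
  have hC := h.nonneg
  set δ := min θ (θ / (4 * (C + 1))) with hδ
  have hδ0 : 0 < δ := lt_min hθ (by positivity)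
  obtain ⟨μ, hμ, hμX⟩ := h.exists_dist_le hM hδ0
  set μ' := min (min μ δ) (θ ^ 2 / (4 * (M + C + 1))) with hμ'
  refine ⟨μ', lt_min (lt_min hμ hδ0) (by positivity), fun x hx y hy z hz hxy hyz hf hd => ?_⟩
  have hl : dist y z ≤ δ := hμX x hx y hy z hz hxy hyz hf
    (hd.trans ((min_le_left _ _).trans (min_le_left _ _)))
  have hl1 : dist x y ≤ δ := hd.trans ((min_le_left _ _).trans (min_le_right _ _))
  refine ⟨hl.trans (min_le_left _ _), ?_⟩
  obtain ⟨A, B, hA0, hA1, hB0, hB1, hA, hB, h1, h2, h3⟩ := h.exists_sqrt hx hy hz hxy hyz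
  set α := inner ℝ (ν y) (sideUnit x y)
  set β := inner ℝ (ν y) (sideUnit y z)
  set g := inner ℝ (sideUnit x y) (sideUnit y z) with hg
  have hd1 : 0 < dist x y := dist_pos.2 hxy
  have hd2 : 0 < dist y z := dist_pos.2 hyz
  have hδC : C * δ ≤ θ / 4 := by
    have : δ ≤ θ / (4 * (C + 1)) := min_le_right _ _
    rw [le_div_iff₀ (by positivity)] at this
    nlinarith
  have hα : |α| ≤ θ / 4 := (h.abs_inner_sideUnit_le hx hy hxy).trans
    ((mul_le_mul_of_nonneg_left hl1 hC).trans hδC)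
  have hβ : |β| ≤ θ / 4 := (h.abs_inner_sideUnit_le' hy hz hyz).trans
    ((mul_le_mul_of_nonneg_left hl hC).trans hδC)
  have hα' : α ^ 2 ≤ θ ^ 2 / 16 := by rw [← sq_abs]; nlinarith [abs_nonneg α]
  have hβ' : β ^ 2 ≤ θ ^ 2 / 16 := by rw [← sq_abs]; nlinarith [abs_nonneg β]
  have h4 : (A * B - (g - α * β)) * (dist x y)⁻¹ ≤ M + C := by
    have e1 : (A * B - (g - α * β)) * (dist x y)⁻¹ ≤
        (A * B - (g - α * β)) * ((dist x y)⁻¹ + (dist y z)⁻¹) :=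
      mul_le_mul_of_nonneg_left (by linarith [inv_pos.2 hd2]) (sub_nonneg.2 h1)
    linarith
  have h5 : A * B - (g - α * β) ≤ θ ^ 2 / 4 := by
    rw [← div_eq_mul_inv, div_le_iff₀ hd1] at h4
    have e1 : dist x y ≤ θ ^ 2 / (4 * (M + C + 1)) := hd.trans (min_le_right _ _)
    rw [le_div_iff₀ (by positivity)] at e1
    linarith
  -- Since `0 ≤ A * B ≤ 1`, the product dominates its square `(1 - α ^ 2) * (1 - β ^ 2)`.
  have h6 : 1 - α ^ 2 - β ^ 2 ≤ A * B := by
    have e1 := mul_le_of_le_one_right (mul_nonneg hA0 hB0) (mul_le_one₀ hA1 hB0 hB1)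
    rw [← sq, mul_pow, hA, hB] at e1
    linarith [mul_nonneg (sq_nonneg α) (sq_nonneg β)]
  have h7 : -(α ^ 2 + β ^ 2) / 2 ≤ α * β := by linarith [sq_nonneg (α + β), add_sq α β]
  have h8 : ‖sideUnit y z - sideUnit x y‖ ^ 2 = 2 - 2 * g := by
    rw [norm_sub_sq_real, norm_sideUnit hxy, norm_sideUnit hyz, real_inner_comm, ← hg]
    ring
  refine (sq_le_sq₀ (norm_nonneg _) hθ.le).1 ?_
  rw [h8]
  linarith [sq_nonneg θ]

variable {n : ℕ}

lemma exists_chain (h : IsStrictNormalField X ν C) {M : ℝ} (hM : 0 ≤ M) (k : ℕ) :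
    ∀ θ > 0, ∃ μ > 0, ∀ x : ZMod n → E, (∀ i, x i ∈ X) → (∀ i, x i ≠ x (i + 1)) →
      (∀ i, vertexForm (ν (x i)) (x (i - 1)) (x i) (x (i + 1)) ≤ M) →
      ∀ j, dist (x j) (x (j + 1)) ≤ μ → ∀ l ≤ k,
        dist (x (j + l)) (x (j + l + 1)) ≤ θ ∧
        ‖sideUnit (x (j + l)) (x (j + l + 1)) - sideUnit (x j) (x (j + 1))‖ ≤ l * θ := by
  induction k with
  | zero =>
    intro θ hθ
    refine ⟨θ, hθ, fun x _ _ _ j hj l hl => ?_⟩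
    obtain rfl : l = 0 := by omega
    simpa using hj
  | succ k ih =>
    intro θ hθ
    obtain ⟨μ₁, hμ₁, h₁⟩ := h.exists_norm_sub_le hM hθ
    -- The first `k` steps must also leave a side shorter than `μ₁`, so that one more step applies.
    obtain ⟨μ, hμ, h₂⟩ := ih (min θ μ₁) (lt_min hθ hμ₁)
    refine ⟨μ, hμ, fun x hx hne hf j hj l hl => ?_⟩
    have hmain := h₂ x hx hne hf j hj
    rcases hl.lt_or_eq with hl | rfl
    · obtain ⟨e1, e2⟩ := hmain l (by omega)
      exact ⟨e1.trans (min_le_left _ _),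
        e2.trans (mul_le_mul_of_nonneg_left (min_le_left _ _) (Nat.cast_nonneg _))⟩
    · obtain ⟨e1, e2⟩ := hmain k le_rfl
      have e3 := h₁ (x (j + k)) (hx _) (x (j + k + 1)) (hx _) (x (j + k + 1 + 1)) (hx _) (hne _)
        (hne _) (by simpa using hf (j + k + 1)) (e1.trans (min_le_right _ _))
      have e4 : j + ((k + 1 : ℕ) : ZMod n) = j + k + 1 := by push_cast; ring
      rw [e4]
      refine ⟨e3.1, ?_⟩
      have e5 := norm_add_le
        (sideUnit (x (j + k + 1)) (x (j + k + 1 + 1)) - sideUnit (x (j + k)) (x (j + k + 1)))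
        (sideUnit (x (j + k)) (x (j + k + 1)) - sideUnit (x j) (x (j + 1)))
      rw [sub_add_sub_cancel] at e5
      have e6 := mul_le_mul_of_nonneg_left (min_le_left θ μ₁) (Nat.cast_nonneg (α := ℝ) k)
      push_cast
      linarith [e3.2]

/-- At polygons with a small product of sides, the tangential gradients of the perimeter and of
the product of the sides have a positive scalar product. -/
theorem exists_sum_vertexForm_pos [NeZero n] (h : IsStrictNormalField X ν C) :
    ∃ ε₀ > 0, ∀ x : ZMod n → E, (∀ i, x i ∈ X) → (∀ i, x i ≠ x (i + 1)) →
      ∏ i, dist (x i) (x (i + 1)) < ε₀ →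
      0 < ∑ i, vertexForm (ν (x i)) (x (i - 1)) (x i) (x (i + 1)) := by
  have hn : (0 : ℝ) < n := Nat.cast_pos.2 (NeZero.pos n)
  have hC := h.nonneg
  -- If the sum is nonpositive and all terms are at least `-C`, no term exceeds `n * C`. At most `n`
  -- turns of size `1 / (2 * n)` keep every side direction within `1 / 2` of the first.
  obtain ⟨μ, hμ, hchain⟩ := h.exists_chain (n := n) (M := n * C) (by positivity) n
    (1 / (2 * n)) (by positivity)
  refine ⟨μ ^ n, by positivity, fun x hx hne hprod => ?_⟩
  by_contra! hsum
  have hlow : ∀ i, -C ≤ vertexForm (ν (x i)) (x (i - 1)) (x i) (x (i + 1)) := fun i =>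
    h.neg_le_vertexForm (hx _) (hx _) (hx _) (by simpa using hne (i - 1)) (hne i)
  have hup : ∀ i, vertexForm (ν (x i)) (x (i - 1)) (x i) (x (i + 1)) ≤ n * C := by
    intro i
    have e1 := Finset.add_sum_erase Finset.univ
      (fun i => vertexForm (ν (x i)) (x (i - 1)) (x i) (x (i + 1))) (Finset.mem_univ i)
    have e2 := Finset.card_nsmul_le_sum (Finset.univ.erase i)
      (fun i => vertexForm (ν (x i)) (x (i - 1)) (x i) (x (i + 1))) (-C) fun j _ => hlow j
    rw [nsmul_eq_mul] at e2
    have e3 : ((Finset.univ.erase i).card : ℝ) ≤ n := by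
      have := Finset.card_le_univ (Finset.univ.erase i)
      rw [ZMod.card] at this
      exact_mod_cast this
    have e4 := mul_le_mul_of_nonneg_right e3 hC
    linarith
  obtain ⟨j, hj⟩ : ∃ j, dist (x j) (x (j + 1)) < μ := by
    by_contra! hcon
    have := Finset.prod_le_prod (s := Finset.univ) (f := fun _ : ZMod n => μ)
      (g := fun i => dist (x i) (x (i + 1))) (fun _ _ => hμ.le) fun i _ => hcon i
    rw [Finset.prod_const, Finset.card_univ, ZMod.card] at this
    linarith
  have hclose : ∀ i, ‖sideUnit (x i) (x (i + 1)) - sideUnit (x j) (x (j + 1))‖ ≤ 1 / 2 := by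
    intro i
    have e1 := (hchain x hx hne hup j hj.le (i - j).val (ZMod.val_lt _).le).2
    rw [ZMod.natCast_zmod_val, add_sub_cancel] at e1
    refine e1.trans ?_
    have e2 : ((i - j).val : ℝ) ≤ n := by exact_mod_cast (ZMod.val_lt _).le
    calc ((i - j).val : ℝ) * (1 / (2 * n)) ≤ n * (1 / (2 * n)) :=
          mul_le_mul_of_nonneg_right e2 (by positivity)
      _ = 1 / 2 := by field_simp
  -- The polygon closes up, so its side vectors sum to zero, whereas each has a positive component
  -- along side `j`.
  have hzero : ∑ i, dist (x i) (x (i + 1)) *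
      inner ℝ (sideUnit (x i) (x (i + 1))) (sideUnit (x j) (x (j + 1))) = 0 := by
    simp_rw [← real_inner_smul_left, dist_smul_sideUnit]
    rw [← sum_inner, Finset.sum_sub_distrib, Equiv.sum_comp (Equiv.addRight (1 : ZMod n)) x |>.symm]
    simp
  have hpos : 0 < ∑ i, dist (x i) (x (i + 1)) *
      inner ℝ (sideUnit (x i) (x (i + 1))) (sideUnit (x j) (x (j + 1))) := by
    refine Finset.sum_pos (fun i _ => mul_pos (dist_pos.2 (hne i)) ?_) Finset.univ_nonempty
    have e1 := norm_sub_sq_real (sideUnit (x i) (x (i + 1))) (sideUnit (x j) (x (j + 1)))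
    rw [norm_sideUnit (hne i), norm_sideUnit (hne j)] at e1
    have e2 := hclose i
    nlinarith [norm_nonneg (sideUnit (x i) (x (i + 1)) - sideUnit (x j) (x (j + 1)))]
  linarith

end IsStrictNormalField

end Vertex

/-! ### From strict convexity to uniform estimates for the unit normal. -/

section Table

variable {E : Type*} [NormedAddCommGroup E] [InnerProductSpace ℝ E]

/-- The compact set `X` is the regular zero set of the smooth function `f`, and no chord of `X` is
tangent to `X`. -/
structure IsTableFunction (X : Set E) (f : E → ℝ) : Prop where
  isCompact : IsCompact X
  contDiff : ContDiff ℝ ∞ f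
  eq_zero_iff : ∀ x, f x = 0 ↔ x ∈ X
  fderiv_ne_zero : ∀ x ∈ X, fderiv ℝ f x ≠ 0
  fderiv_chord_ne_zero : ∀ x ∈ X, ∀ y ∈ X, x ≠ y → fderiv ℝ f x (y - x) ≠ 0

/-- As `f < 0` inside, its differential at `x` is nonpositive on vectors pointing to interior
points. The midpoint of a chord is interior; if the chord were tangent, the differential would be
nonpositive on a neighbourhood of a kernel vector, hence zero. -/
theorem IsClosedStrictlyConvexHypersurface.exists_isTableFunction [FiniteDimensional ℝ E]
    {X : Set E} (hX : IsClosedStrictlyConvexHypersurface X) : ∃ f, IsTableFunction X f := by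
  obtain ⟨K, hKc, hKs, hKi, hXK⟩ := hX.table
  obtain ⟨f, hf, hf0, hfi, hf'⟩ := exists_definingFunction hX.smooth hKs.convex hKi hXK
  refine ⟨f, ?_, hf, hf0, hf', fun x hx y hy hxy h0 => ?_⟩
  · rw [hXK]
    exact hKc.of_isClosed_subset isClosed_frontier hKc.isClosed.frontier_subset
  have hfd : HasFDerivAt f (fderiv ℝ f x) x := (hf.differentiable (by simp) x).hasFDerivAt
  have hXK' : X ⊆ K := hXK ▸ hKc.isClosed.frontier_subset
  have hnonpos : ∀ z ∈ interior K, fderiv ℝ f x (z - x) ≤ 0 := by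
    intro z hz
    by_contra! hpos
    have h1 : HasDerivAt (fun t : ℝ => f (x + t • (z - x))) (fderiv ℝ f x (z - x)) 0 := by
      have : HasFDerivAt f (fderiv ℝ f x) (x + (0 : ℝ) • (z - x)) := by simpa using hfd
      exact this.comp_hasDerivAt 0 (hasDerivAt_add_smul x (z - x) 0)
    have h2 := eventually_pos_of_hasDerivAt_pos h1 (by simp [(hf0 x).2 hx]) hpos
    have h3 : ∀ᶠ t in 𝓝[>] (0 : ℝ), t ≤ 1 :=
      Filter.Eventually.filter_mono nhdsWithin_le_nhds (eventually_le_nhds one_pos)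
    obtain ⟨t, ⟨ht, ht1⟩, ht0⟩ := ((h2.and h3).and self_mem_nhdsWithin).exists
    have := hfi _ (hKs.convex.add_smul_sub_mem_interior (hXK' hx) hz ⟨ht0, ht1⟩)
    linarith
  have hmid : x + (1 / 2 : ℝ) • (y - x) ∈ interior K := by
    have h1 := hKs (hXK' hx) (hXK' hy) hxy (a := 1 / 2) (b := 1 / 2) (by norm_num) (by norm_num)
      (by norm_num)
    convert h1 using 1
    module
  refine hf' x hx (ContinuousLinearMap.ext fun w => ?_)
  have hle : ∀ w, fderiv ℝ f x w ≤ 0 := by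
    intro w
    have h1 : ContinuousAt (fun δ : ℝ => x + (1 / 2 : ℝ) • (y - x) + δ • w) 0 := by fun_prop
    have h2 : ∀ᶠ δ in 𝓝[>] (0 : ℝ), x + (1 / 2 : ℝ) • (y - x) + δ • w ∈ interior K :=
      Filter.Eventually.filter_mono nhdsWithin_le_nhds
        (h1.eventually_mem (isOpen_interior.mem_nhds (by simpa using hmid)))
    obtain ⟨δ, hδ, hδ0⟩ := (h2.and self_mem_nhdsWithin).exists
    have h3 := hnonpos _ hδ
    have h4 : x + (1 / 2 : ℝ) • (y - x) + δ • w - x = (1 / 2 : ℝ) • (y - x) + δ • w := by abel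
    rw [h4, map_add, map_smul, h0, smul_zero, zero_add, map_smul, smul_eq_mul] at h3
    exact nonpos_of_mul_nonpos_right h3 hδ0
  refine le_antisymm (hle w) ?_
  have := hle (-w)
  rw [map_neg] at this
  exact neg_nonpos.1 this

/-- First-order Taylor estimate between two zeros of `f`, with a Lipschitz constant of `fderiv ℝ f`
on a ball containing `X`. -/
lemma IsTableFunction.exists_abs_fderiv_le [FiniteDimensional ℝ E] {X : Set E} {f : E → ℝ}
    (h : IsTableFunction X f) :
    ∃ L ≥ 0, ∀ y ∈ X, ∀ x ∈ X, |fderiv ℝ f y (x - y)| ≤ L * dist x y ^ 2 := by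
  obtain ⟨R, hR⟩ := h.isCompact.isBounded.subset_closedBall 0
  obtain ⟨L, hL⟩ := (contDiff_infty_iff_fderiv.1 h.contDiff).2.contDiffOn.exists_lipschitzOnWith
    (by simp) (convex_closedBall (0 : E) R) (isCompact_closedBall 0 R)
  refine ⟨L, L.2, fun y hy x hx => ?_⟩
  have h1 := ((convex_closedBall (0 : E) R).inter
    (convex_closedBall y (dist x y))).norm_image_sub_le_of_norm_hasFDerivWithin_le'
    (f := f) (f' := fderiv ℝ f) (φ := fderiv ℝ f y) (C := L * dist x y) (x := y) (y := x)
    (fun z _ => (h.contDiff.differentiable (by simp) z).hasFDerivAt.hasFDerivWithinAt)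
    (fun z hz => ?_) ⟨hR hy, by simp⟩ ⟨hR hx, Metric.mem_closedBall.2 le_rfl⟩
  · rw [(h.eq_zero_iff x).2 hx, (h.eq_zero_iff y).2 hy, sub_self, zero_sub, norm_neg,
      Real.norm_eq_abs, ← dist_eq_norm, mul_assoc, ← sq] at h1
    exact h1
  · rw [← dist_eq_norm]
    exact (hL.dist_le_mul z hz.1 y (hR hy)).trans
      (mul_le_mul_of_nonneg_left (Metric.mem_closedBall.1 hz.2) L.2)

variable [CompleteSpace E]

lemma inner_gradient_eq (f : E → ℝ) (x v : E) : inner ℝ (gradient f x) v = fderiv ℝ f x v :=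
  InnerProductSpace.toDual_symm_apply

lemma norm_gradient (f : E → ℝ) (x : E) : ‖gradient f x‖ = ‖fderiv ℝ f x‖ :=
  LinearIsometryEquiv.norm_map _ _

/-- The unit normal of the level set of `f`. -/
def unitNormal (f : E → ℝ) (x : E) : E := ‖gradient f x‖⁻¹ • gradient f x

lemma inner_unitNormal (f : E → ℝ) (x v : E) :
    inner ℝ (unitNormal f x) v = ‖fderiv ℝ f x‖⁻¹ * fderiv ℝ f x v := by
  rw [unitNormal, real_inner_smul_left, inner_gradient_eq, norm_gradient]

namespace IsTableFunction

variable {X : Set E} {f : E → ℝ}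

theorem exists_isStrictNormalField [FiniteDimensional ℝ E] (h : IsTableFunction X f) :
    ∃ C, IsStrictNormalField X (unitNormal f) C := by
  obtain ⟨L, hL0, hL⟩ := h.exists_abs_fderiv_le
  have hcont : Continuous (fderiv ℝ f) := h.contDiff.continuous_fderiv (by simp)
  have hpos : ∀ y ∈ X, 0 < ‖fderiv ℝ f y‖ := fun y hy => norm_pos_iff.2 (h.fderiv_ne_zero y hy)
  obtain ⟨b, hb, hbX⟩ : ∃ b > 0, ∀ y ∈ X, b ≤ ‖fderiv ℝ f y‖ := by
    rcases X.eq_empty_or_nonempty with rfl | hne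
    · exact ⟨1, one_pos, fun y hy => hy.elim⟩
    · obtain ⟨y, hy, hmin⟩ := h.isCompact.exists_isMinOn hne hcont.norm.continuousOn
      exact ⟨_, hpos y hy, fun z hz => hmin hz⟩
  refine ⟨b⁻¹ * L, fun y hy => ?_, by positivity, fun y hy x hx => ?_, fun δ hδ => ?_⟩
  · rw [unitNormal, norm_smul, norm_inv, norm_norm, norm_gradient, inv_mul_cancel₀ (hpos y hy).ne']
  · rw [inner_unitNormal, abs_mul, abs_inv, abs_norm, mul_assoc]
    exact mul_le_mul (inv_anti₀ hb (hbX y hy)) (hL y hy x hx) (abs_nonneg _) (inv_nonneg.2 hb.le)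
  -- Chords of length at least `δ` form a compact set on which the normalised transversality `q` is
  -- continuous and positive.
  · set S : Set (E × E) := (X ×ˢ X) ∩ {z | δ ≤ dist z.2 z.1} with hS
    have hSc : IsCompact S := (h.isCompact.prod h.isCompact).inter_right
      (isClosed_le continuous_const (continuous_snd.dist continuous_fst))
    let q : E × E → ℝ := fun z =>
      |‖fderiv ℝ f z.1‖⁻¹ * fderiv ℝ f z.1 (z.2 - z.1)| / dist z.2 z.1
    have hdpos : ∀ z ∈ S, 0 < dist z.2 z.1 := fun z hz => lt_of_lt_of_le hδ hz.2
    have hq : ContinuousOn q S := by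
      have h1 : Continuous fun z : E × E => fderiv ℝ f z.1 := hcont.comp continuous_fst
      refine ContinuousOn.div (ContinuousOn.abs (ContinuousOn.mul (ContinuousOn.inv₀
        h1.norm.continuousOn fun z hz => (hpos z.1 hz.1.1).ne') (h1.clm_apply
          (continuous_snd.sub continuous_fst)).continuousOn))
        (continuous_snd.dist continuous_fst).continuousOn fun z hz => (hdpos z hz).ne'
    have hqpos : ∀ z ∈ S, 0 < q z := by
      intro z hz
      have hne : z.1 ≠ z.2 := fun e => by
        have := hdpos z hz
        rw [e, dist_self] at this
        exact lt_irrefl _ this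
      exact div_pos (abs_pos.2 (mul_ne_zero (inv_ne_zero (hpos z.1 hz.1.1).ne')
        (h.fderiv_chord_ne_zero _ hz.1.1 _ hz.1.2 hne))) (hdpos z hz)
    obtain ⟨η, hη, hηS⟩ : ∃ η > 0, ∀ z ∈ S, η ≤ q z := by
      rcases S.eq_empty_or_nonempty with he | hne
      · exact ⟨1, one_pos, fun z hz => (he ▸ hz : z ∈ (∅ : Set (E × E))).elim⟩
      · obtain ⟨z, hz, hmin⟩ := hSc.exists_isMinOn hne hq
        exact ⟨_, hqpos z hz, fun w hw => hmin hw⟩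
    refine ⟨η, hη, fun y hy x hx hxy => ?_⟩
    have hz : (y, x) ∈ S := ⟨⟨hy, hx⟩, hxy⟩
    rw [inner_unitNormal]
    have h1 : η ≤ |‖fderiv ℝ f y‖⁻¹ * fderiv ℝ f y (x - y)| / dist x y := hηS (y, x) hz
    have h2 : 0 < dist x y := hdpos (y, x) hz
    exact (le_div_iff₀ h2).1 h1

end IsTableFunction

end Table

/-! ### Tangent spaces and gradients on subsets. -/

section Tangent

variable {V : Type*} [NormedAddCommGroup V] [InnerProductSpace ℝ V]

lemma fderiv_apply_eq_zero_of_mem_tangentSpaceOf {W : Type*} [NormedAddCommGroup W]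
    [NormedSpace ℝ W] {S : Set V} {p v : V} {g : V → W} {c : W} (hg : DifferentiableAt ℝ g p)
    (hS : ∀ x ∈ S, g x = c) (hv : v ∈ tangentSpaceOf S p) : fderiv ℝ g p v = 0 := by
  suffices h : tangentSpaceOf S p ≤ LinearMap.ker (fderiv ℝ g p).toLinearMap from h hv
  refine Submodule.span_le.2 ?_
  rintro _ ⟨γ, hγ, hγ0, hγS, rfl⟩
  change fderiv ℝ g p (deriv γ 0) = 0
  have h1 : HasFDerivAt g (fderiv ℝ g p) (γ 0) := by rw [hγ0]; exact hg.hasFDerivAt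
  have h2 := h1.comp_hasDerivAt 0 (hγ.differentiableAt (by simp)).hasDerivAt
  have h3 : HasDerivAt (g ∘ γ) 0 0 :=
    (hasDerivAt_const (0 : ℝ) c).congr_of_eventuallyEq (hγS.mono fun t ht => hS _ ht)
  exact h2.unique h3

lemma gradientOn_mem [FiniteDimensional ℝ V] (f : V → ℝ) (S : Set V) (p : V) :
    gradientOn f S p ∈ tangentSpaceOf S p := Subtype.property _

lemma inner_gradientOn [FiniteDimensional ℝ V] (f : V → ℝ) (S : Set V) {p w : V}
    (hw : w ∈ tangentSpaceOf S p) : inner ℝ (gradientOn f S p) w = fderiv ℝ f p w := by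
  have : CompleteSpace (tangentSpaceOf S p) := FiniteDimensional.complete ℝ _
  exact InnerProductSpace.toDual_symm_apply (𝕜 := ℝ) (x := (⟨w, hw⟩ : tangentSpaceOf S p))
    (y := (fderiv ℝ f p).comp (tangentSpaceOf S p).subtypeL)

lemma hasFDerivAt_norm_comp {W : Type*} [NormedAddCommGroup W] [NormedSpace ℝ W] (L : W →L[ℝ] V)
    {x : W} (h : L x ≠ 0) :
    HasFDerivAt (fun x => ‖L x‖) ((innerSL ℝ (‖L x‖⁻¹ • L x)).comp L) x := by
  have h0 : ‖L x‖ ≠ 0 := norm_ne_zero_iff.2 h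
  have h1 := (L.hasFDerivAt (x := x)).norm_sq.sqrt (pow_ne_zero 2 h0)
  simp only [Real.sqrt_sq (norm_nonneg _)] at h1
  refine h1.congr_fderiv (ContinuousLinearMap.ext fun v => ?_)
  simp
  ring

end Tangent

/-! ### Derivatives of the perimeter and of the product of the sides. -/

section PolygonCalculus

variable {m n : ℕ}

/-- The vertex `i` of a polygon, as a linear map. -/
def vertexL (m n : ℕ) (i : ZMod n) : Polygon m n →L[ℝ] EuclideanSpace ℝ (Fin (m + 1)) :=
  PiLp.proj 2 _ i

/-- The side from the vertex `i` of a polygon, as a linear map. -/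
def sideL (m n : ℕ) (i : ZMod n) : Polygon m n →L[ℝ] EuclideanSpace ℝ (Fin (m + 1)) :=
  vertexL m n (i + 1) - vertexL m n i

@[simp] lemma vertexL_apply (i : ZMod n) (x : Polygon m n) : vertexL m n i x = x i := rfl

@[simp] lemma sideL_apply (i : ZMod n) (x : Polygon m n) : sideL m n i x = x (i + 1) - x i := rfl

/-- The vertices of the polygon, read through the function `f`. -/
def vertexValues (f : EuclideanSpace ℝ (Fin (m + 1)) → ℝ) (x : Polygon m n) (i : ZMod n) : ℝ :=
  f (x i)

lemma dist_eq_norm_sideL (x : Polygon m n) (i : ZMod n) :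
    dist (x i) (x (i + 1)) = ‖sideL m n i x‖ := by
  rw [sideL_apply, dist_eq_norm']

variable [NeZero n]

instance continuousSMul_polygon : ContinuousSMul ℝ (Polygon m n) := IsBoundedSMul.continuousSMul

lemma hasFDerivAt_dist {x : Polygon m n} {i : ZMod n} (h : x i ≠ x (i + 1)) :
    HasFDerivAt (fun x : Polygon m n => dist (x i) (x (i + 1)))
      ((innerSL ℝ (sideUnit (x i) (x (i + 1)))).comp (sideL m n i)) x := by
  have h1 := hasFDerivAt_norm_comp (sideL m n i) (x := x) (sub_ne_zero.2 h.symm)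
  simp only [dist_eq_norm_sideL]
  rw [sideUnit, dist_eq_norm_sideL]
  exact h1

lemma contDiff_vertexValues {f : EuclideanSpace ℝ (Fin (m + 1)) → ℝ} (hf : ContDiff ℝ ∞ f) :
    ContDiff ℝ ∞ (vertexValues f : Polygon m n → ZMod n → ℝ) :=
  contDiff_pi.2 fun i => hf.comp (vertexL m n i).contDiff

lemma fderiv_vertexValues {f : EuclideanSpace ℝ (Fin (m + 1)) → ℝ} (hf : ContDiff ℝ ∞ f)
    (x v : Polygon m n) (i : ZMod n) :
    fderiv ℝ (vertexValues f : Polygon m n → ZMod n → ℝ) x v i = fderiv ℝ f (x i) (v i) := by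
  have h : HasFDerivAt (vertexValues f : Polygon m n → ZMod n → ℝ)
      (ContinuousLinearMap.pi fun i => (fderiv ℝ f (x i)).comp (vertexL m n i)) x :=
    hasFDerivAt_pi.2 fun i =>
      (hf.differentiable (by simp) (x i)).hasFDerivAt.comp x (vertexL m n i).hasFDerivAt
  rw [h.fderiv]
  rfl

lemma surjective_fderiv_vertexValues {f : EuclideanSpace ℝ (Fin (m + 1)) → ℝ}
    (hf : ContDiff ℝ ∞ f) {x : Polygon m n} (hx : ∀ i, fderiv ℝ f (x i) ≠ 0) :
    Function.Surjective (fderiv ℝ (vertexValues f : Polygon m n → ZMod n → ℝ) x) := by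
  intro y
  have h : ∀ i, ∃ v, fderiv ℝ f (x i) v = y i := fun i => by
    obtain ⟨w, hw⟩ := DFunLike.ne_iff.1 (hx i)
    refine ⟨(y i / fderiv ℝ f (x i) w) • w, ?_⟩
    rw [map_smul, smul_eq_mul, div_mul_cancel₀ _ hw]
  choose v hv using h
  refine ⟨WithLp.toLp 2 v, funext fun i => ?_⟩
  rw [fderiv_vertexValues hf]
  exact hv i

/-- The gradient of the logarithm of the product of the sides of a polygon. -/
def logGradient (x : Polygon m n) : Polygon m n :=
  WithLp.toLp 2 fun i => (dist (x (i - 1)) (x i))⁻¹ • sideUnit (x (i - 1)) (x i) -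
    (dist (x i) (x (i + 1)))⁻¹ • sideUnit (x i) (x (i + 1))

/-- Cyclic summation by parts: it turns sums over sides into sums over vertices. -/
lemma sum_inner_sideL (a : ZMod n → EuclideanSpace ℝ (Fin (m + 1))) (v : Polygon m n) :
    ∑ i, inner ℝ (a i) (sideL m n i v) = ∑ i, inner ℝ (a (i - 1) - a i) (v i) := by
  simp only [sideL_apply, inner_sub_right, inner_sub_left, Finset.sum_sub_distrib]
  congr 1
  refine Fintype.sum_equiv (Equiv.addRight 1) _ _ fun i => ?_
  simp

lemma hasFDerivAt_negPerimeter {x : Polygon m n} (hx : ∀ i, x i ≠ x (i + 1)) :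
    HasFDerivAt (negPerimeter : Polygon m n → ℝ)
      (-∑ i, (innerSL ℝ (sideUnit (x i) (x (i + 1)))).comp (sideL m n i)) x :=
  (HasFDerivAt.fun_sum fun i _ => hasFDerivAt_dist (hx i)).neg

lemma fderiv_negPerimeter {x : Polygon m n} (hx : ∀ i, x i ≠ x (i + 1)) (v : Polygon m n) :
    fderiv ℝ negPerimeter x v =
      -∑ i, inner ℝ (sideUnit (x (i - 1)) (x i) - sideUnit (x i) (x (i + 1))) (v i) := by
  rw [(hasFDerivAt_negPerimeter hx).fderiv]
  have h := sum_inner_sideL (fun i => sideUnit (x i) (x (i + 1))) v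
  simp only [sub_add_cancel] at h
  rw [← h]
  simp

lemma differentiableAt_sideProduct {x : Polygon m n} (hx : ∀ i, x i ≠ x (i + 1)) :
    DifferentiableAt ℝ (sideProduct : Polygon m n → ℝ) x :=
  (HasFDerivAt.finsetProd (u := Finset.univ) fun i _ => hasFDerivAt_dist (hx i)).differentiableAt

lemma fderiv_sideProduct {x : Polygon m n} (hx : ∀ i, x i ≠ x (i + 1)) (v : Polygon m n) :
    fderiv ℝ sideProduct x v = sideProduct x * inner ℝ (logGradient x) v := by
  have h1 : HasFDerivAt (sideProduct : Polygon m n → ℝ) _ x :=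
    HasFDerivAt.finsetProd (u := Finset.univ) fun i _ => hasFDerivAt_dist (hx i)
  rw [h1.fderiv, PiLp.inner_apply]
  have h := sum_inner_sideL (fun i => (dist (x i) (x (i + 1)))⁻¹ • sideUnit (x i) (x (i + 1))) v
  simp only [sub_add_cancel] at h
  change _ = sideProduct x * ∑ i, inner ℝ ((dist (x (i - 1)) (x i))⁻¹ • sideUnit (x (i - 1)) (x i) -
    (dist (x i) (x (i + 1)))⁻¹ • sideUnit (x i) (x (i + 1))) (v i)
  rw [← h, Finset.mul_sum, sum_apply]
  refine Finset.sum_congr rfl fun i _ => ?_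
  have h2 : sideProduct x = dist (x i) (x (i + 1)) *
      ∏ j ∈ Finset.univ.erase i, dist (x j) (x (j + 1)) :=
    (Finset.mul_prod_erase _ _ (Finset.mem_univ i)).symm
  have h3 : dist (x i) (x (i + 1)) ≠ 0 := dist_ne_zero.2 (hx i)
  rw [h2, real_inner_smul_left, smul_apply, ContinuousLinearMap.comp_apply,
    innerSL_apply_apply, smul_eq_mul]
  field_simp

/-- The square of the product of the sides of a polygon. -/
def sqSideProduct (x : Polygon m n) : ℝ := ∏ i, ‖sideL m n i x‖ ^ 2

lemma sqSideProduct_eq (x : Polygon m n) : sqSideProduct x = sideProduct x ^ 2 := by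
  simp only [sqSideProduct, sideProduct, dist_eq_norm_sideL, Finset.prod_pow]

/-- Unlike the product itself, its square is smooth also at polygons with vanishing sides, so it
serves as a global function. -/
lemma contDiff_sqSideProduct : ContDiff ℝ ∞ (sqSideProduct : Polygon m n → ℝ) :=
  contDiff_prod fun i _ => (sideL m n i).contDiff.norm_sq ℝ

lemma fderiv_sqSideProduct {x : Polygon m n} (hx : ∀ i, x i ≠ x (i + 1)) (v : Polygon m n) :
    fderiv ℝ sqSideProduct x v = 2 * sideProduct x ^ 2 * inner ℝ (logGradient x) v := by
  have h : (sqSideProduct : Polygon m n → ℝ) = fun x => sideProduct x ^ 2 :=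
    funext sqSideProduct_eq
  have h1 := (differentiableAt_sideProduct hx).hasFDerivAt.pow 2
  have h2 := fderiv_sideProduct hx v
  rw [h, h1.fderiv, smul_apply, h2]
  simp
  ring

lemma sideProduct_nonneg (x : Polygon m n) : 0 ≤ sideProduct x :=
  Finset.prod_nonneg fun _ _ => dist_nonneg

lemma continuous_sideProduct : Continuous (sideProduct : Polygon m n → ℝ) :=
  continuous_finsetProd _ fun i _ => (vertexL m n i).continuous.dist (vertexL m n (i + 1)).continuous

lemma sideProduct_pos_iff {x : Polygon m n} : 0 < sideProduct x ↔ ∀ i, x i ≠ x (i + 1) := by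
  refine ⟨fun h i hi => ?_, fun h => Finset.prod_pos fun i _ => dist_pos.2 (h i)⟩
  exact h.ne' (Finset.prod_eq_zero (Finset.mem_univ i) (dist_eq_zero.2 hi))

lemma finrank_polygon (m n : ℕ) [NeZero n] :
    Module.finrank ℝ (Polygon m n) = m * n + Module.finrank ℝ (ZMod n → ℝ) := by
  rw [(WithLp.linearEquiv 2 ℝ (∀ _ : ZMod n, EuclideanSpace ℝ (Fin (m + 1)))).finrank_eq,
    Module.finrank_pi_fintype]
  simp [ZMod.card]
  ring

end PolygonCalculus

/-! ### The boundary level: regularity, critical points and the outward gradient. -/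

section Truncation

variable {m n : ℕ}

/-- The projection of the vector `v` at the polygon `x` to the tangent spaces at the vertices. -/
def tangentialPart (f : EuclideanSpace ℝ (Fin (m + 1)) → ℝ) (x v : Polygon m n) : Polygon m n :=
  WithLp.toLp 2 fun i => v i - inner ℝ (unitNormal f (x i)) (v i) • unitNormal f (x i)

namespace IsTableFunction

variable {X : Set (EuclideanSpace ℝ (Fin (m + 1)))} {f : EuclideanSpace ℝ (Fin (m + 1)) → ℝ}

lemma vertexValues_eq_zero_iff (h : IsTableFunction X f) {x : Polygon m n} :
    vertexValues f x = 0 ↔ ∀ i, x i ∈ X := by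
  rw [funext_iff]
  exact forall_congr' fun i => h.eq_zero_iff (x i)

lemma fderiv_tangentialPart (h : IsTableFunction X f) {x v : Polygon m n} (hx : ∀ i, x i ∈ X)
    (i : ZMod n) : fderiv ℝ f (x i) (tangentialPart f x v i) = 0 := by
  obtain ⟨C, hC⟩ := h.exists_isStrictNormalField
  have h1 : inner ℝ (unitNormal f (x i)) (tangentialPart f x v i) = (0 : ℝ) := by
    change inner ℝ (unitNormal f (x i))
      (v i - inner ℝ (unitNormal f (x i)) (v i) • unitNormal f (x i)) = (0 : ℝ)
    rw [inner_sub_right, real_inner_smul_right, real_inner_self_eq_norm_sq, hC.norm_eq _ (hx i)]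
    ring
  rw [inner_unitNormal] at h1
  exact (mul_eq_zero.1 h1).resolve_left (inv_ne_zero (norm_ne_zero_iff.2 (h.fderiv_ne_zero _ (hx i))))

variable [NeZero n]

lemma inner_tangentialPart {x v w : Polygon m n}
    (hw : ∀ i, fderiv ℝ f (x i) (w i) = 0) : inner ℝ (tangentialPart f x v) w = inner ℝ v w := by
  rw [PiLp.inner_apply, PiLp.inner_apply]
  refine Finset.sum_congr rfl fun i _ => ?_
  change inner ℝ (v i - inner ℝ (unitNormal f (x i)) (v i) • unitNormal f (x i)) (w i) = _
  rw [inner_sub_left, real_inner_smul_left, inner_unitNormal f (x i) (w i), hw, mul_zero, mul_zero,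
    sub_zero]

lemma fderiv_vertexValues_eq_zero_iff (h : IsTableFunction X f) {x v : Polygon m n} :
    fderiv ℝ (vertexValues f : Polygon m n → ZMod n → ℝ) x v = 0 ↔
      ∀ i, fderiv ℝ f (x i) (v i) = 0 := by
  rw [funext_iff]
  exact forall_congr' fun i => by rw [fderiv_vertexValues h.contDiff]; rfl

lemma fderiv_negPerimeter_tangentialPart (h : IsTableFunction X f) {x : Polygon m n}
    (hx : x ∈ cyclicConfig X n) :
    fderiv ℝ negPerimeter x (tangentialPart f x (logGradient x)) =
      -∑ i, vertexForm (unitNormal f (x i)) (x (i - 1)) (x i) (x (i + 1)) := by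
  obtain ⟨C, hC⟩ := h.exists_isStrictNormalField
  rw [fderiv_negPerimeter hx.2]
  congr 1
  refine Finset.sum_congr rfl fun i _ => ?_
  have h1 : x (i - 1) ≠ x i := by simpa using hx.2 (i - 1)
  have hν := hC.norm_eq _ (hx.1 i)
  change inner ℝ (sideUnit (x (i - 1)) (x i) - sideUnit (x i) (x (i + 1)))
    (((dist (x (i - 1)) (x i))⁻¹ • sideUnit (x (i - 1)) (x i) -
      (dist (x i) (x (i + 1)))⁻¹ • sideUnit (x i) (x (i + 1))) -
      inner ℝ (unitNormal f (x i)) ((dist (x (i - 1)) (x i))⁻¹ • sideUnit (x (i - 1)) (x i) -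
      (dist (x i) (x (i + 1)))⁻¹ • sideUnit (x i) (x (i + 1))) • unitNormal f (x i)) = _
  have hu : inner ℝ (sideUnit (x (i - 1)) (x i)) (sideUnit (x (i - 1)) (x i)) = (1 : ℝ) := by
    rw [real_inner_self_eq_norm_sq, norm_sideUnit h1, one_pow]
  have hu' : inner ℝ (sideUnit (x i) (x (i + 1))) (sideUnit (x i) (x (i + 1))) = (1 : ℝ) := by
    rw [real_inner_self_eq_norm_sq, norm_sideUnit (hx.2 i), one_pow]
  rw [vertexForm]
  set u := sideUnit (x (i - 1)) (x i)
  set u' := sideUnit (x i) (x (i + 1))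
  set ν := unitNormal f (x i)
  simp only [inner_sub_left, inner_sub_right, real_inner_smul_right, hu, hu',
    real_inner_comm u u', real_inner_comm ν u, real_inner_comm ν u']
  ring

/-- `G(X, n)` is open in the regular level set `X ^ n` of `vertexValues f`, so a curve in the level
set stays in it for small times. -/
lemma mem_tangentSpaceOf_cyclicConfig_iff (h : IsTableFunction X f) {x v : Polygon m n}
    (hx : x ∈ cyclicConfig X n) :
    v ∈ tangentSpaceOf (cyclicConfig X n) x ↔ ∀ i, fderiv ℝ f (x i) (v i) = 0 := by
  rw [← h.fderiv_vertexValues_eq_zero_iff]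
  have hG := contDiff_vertexValues (m := m) (n := n) h.contDiff
  refine ⟨fun hv => fderiv_apply_eq_zero_of_mem_tangentSpaceOf (hG.differentiable (by simp) x)
    (fun y hy => h.vertexValues_eq_zero_iff.2 hy.1) hv, fun hv => ?_⟩
  obtain ⟨γ, hγ, hγ0, hγG, hγv⟩ := exists_curve_of_submersion hG
    (h.vertexValues_eq_zero_iff.2 hx.1)
    (surjective_fderiv_vertexValues h.contDiff fun i => h.fderiv_ne_zero _ (hx.1 i)) hv
  refine Submodule.subset_span ⟨γ, hγ, hγ0, ?_, hγv.deriv⟩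
  have h1 : ∀ᶠ t in 𝓝 (0 : ℝ), 0 < sideProduct (γ t) := by
    have h2 : ContinuousAt (fun t => sideProduct (γ t)) 0 :=
      continuous_sideProduct.continuousAt.comp hγ.continuousAt
    exact h2.eventually (lt_mem_nhds (by simpa only [hγ0] using sideProduct_pos_iff.2 hx.2))
  filter_upwards [hγG, h1] with t ht1 ht2
  exact ⟨h.vertexValues_eq_zero_iff.1 ht1, sideProduct_pos_iff.1 ht2⟩

lemma exists_fderiv_negPerimeter_neg (h : IsTableFunction X f) :
    ∃ ε₀ > 0, ∀ x : Polygon m n, x ∈ cyclicConfig X n → sideProduct x < ε₀ →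
      fderiv ℝ negPerimeter x (tangentialPart f x (logGradient x)) < 0 := by
  obtain ⟨C, hC⟩ := h.exists_isStrictNormalField
  obtain ⟨ε₀, hε₀, H⟩ := hC.exists_sum_vertexForm_pos (n := n)
  refine ⟨ε₀, hε₀, fun x hx hlt => ?_⟩
  rw [h.fderiv_negPerimeter_tangentialPart hx, neg_lt_zero]
  exact H x hx.1 hx.2 hlt

/-- Symmetry of the metric: the tangential part of `logGradient x` is the gradient of `log P` on
`G(X, n)`, so either gradient may be paired with the differential of the other function. -/
lemma fderiv_sideProduct_gradientOn (h : IsTableFunction X f) {x : Polygon m n}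
    (hx : x ∈ cyclicConfig X n) :
    fderiv ℝ sideProduct x (gradientOn negPerimeter (cyclicConfig X n) x) =
      sideProduct x * fderiv ℝ negPerimeter x (tangentialPart f x (logGradient x)) := by
  have h1 := (h.mem_tangentSpaceOf_cyclicConfig_iff hx).1
    (gradientOn_mem negPerimeter (cyclicConfig X n) x)
  have h2 := (h.mem_tangentSpaceOf_cyclicConfig_iff hx).2
    (fun i => h.fderiv_tangentialPart (v := logGradient x) hx.1 i)
  rw [fderiv_sideProduct hx.2, ← inner_tangentialPart h1, real_inner_comm, inner_gradientOn _ _ h2]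

theorem isOutwardAt_gradientOn (h : IsTableFunction X f) {ε : ℝ} (hε : 0 < ε) {x : Polygon m n}
    (hx : x ∈ truncatedConfigBoundary X n ε)
    (hneg : fderiv ℝ negPerimeter x (tangentialPart f x (logGradient x)) < 0) :
    IsOutwardAt (truncatedConfig X n ε) (truncatedConfigBoundary X n ε) x
      (gradientOn negPerimeter (cyclicConfig X n) x) := by
  have hxc : x ∈ cyclicConfig X n := truncatedConfig_subset X n hε ⟨hx.1, hx.2.ge⟩
  set g := gradientOn negPerimeter (cyclicConfig X n) x with hg
  have hdiff := differentiableAt_sideProduct hxc.2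
  have hlt : fderiv ℝ sideProduct x g < 0 := by
    rw [h.fderiv_sideProduct_gradientOn hxc, hx.2]
    exact mul_neg_of_pos_of_neg hε hneg
  refine ⟨fun hmem => hlt.ne
    (fderiv_apply_eq_zero_of_mem_tangentSpaceOf hdiff (fun y hy => hy.2) hmem), ?_⟩
  have hgt := (h.mem_tangentSpaceOf_cyclicConfig_iff hxc).1
    (gradientOn_mem negPerimeter (cyclicConfig X n) x)
  obtain ⟨γ, hγ, hγ0, hγG, hγv⟩ := exists_curve_of_submersion
    (contDiff_vertexValues (m := m) (n := n) h.contDiff) (h.vertexValues_eq_zero_iff.2 hxc.1)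
    (surjective_fderiv_vertexValues h.contDiff fun i => h.fderiv_ne_zero _ (hxc.1 i))
    (h.fderiv_vertexValues_eq_zero_iff.2 hgt)
  refine ⟨γ, hγ, hγ0, ?_, hγv.deriv⟩
  have h1 : HasDerivAt (fun t => sideProduct (γ t)) (fderiv ℝ sideProduct x g) 0 := by
    have : HasFDerivAt sideProduct (fderiv ℝ sideProduct x) (γ 0) := by
      rw [hγ0]; exact hdiff.hasFDerivAt
    exact this.comp_hasDerivAt 0 hγv
  -- Time is reversed: the side product decreases along `γ` at time `0`, so it exceeds `ε` just
  -- before.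
  have h2 : HasDerivAt (fun t => sideProduct (γ (-t)) - ε) (-fderiv ℝ sideProduct x g) 0 := by
    have h3 : HasDerivAt (fun t => sideProduct (γ t)) (fderiv ℝ sideProduct x g) (-0) := by
      rwa [neg_zero]
    simpa using! (h3.comp (0 : ℝ) (hasDerivAt_neg 0)).sub_const ε
  have h4 := eventually_pos_of_hasDerivAt_pos h2 (by simp [hγ0, hx.2]) (neg_pos.2 hlt)
  rw [eventually_nhdsWithin_iff] at h4 ⊢
  have h5 : Filter.Tendsto (fun t : ℝ => -t) (𝓝 0) (𝓝 0) := by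
    simpa using (continuous_neg (G := ℝ)).tendsto 0
  filter_upwards [h5.eventually h4, hγG] with t ht1 ht2 ht3
  refine ⟨h.vertexValues_eq_zero_iff.1 ht2, ?_⟩
  have ht3 : t ≤ 0 := ht3
  rcases ht3.eq_or_lt with rfl | ht
  · rw [hγ0, hx.2]
  · have := ht1 (neg_pos.2 ht)
    rw [neg_neg] at this
    linarith

theorem isSmoothSubmanifoldWithBoundary_truncatedConfig [NeZero m] (h : IsTableFunction X f) {ε : ℝ}
    (hε : 0 < ε) (hneg : ∀ x ∈ truncatedConfigBoundary X n ε,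
      fderiv ℝ negPerimeter x (tangentialPart f x (logGradient x)) < 0) :
    IsSmoothSubmanifoldWithBoundary (m * n) (truncatedConfig X n ε)
      (truncatedConfigBoundary X n ε) := by
  have h1 : truncatedConfig X n ε =
      {x : Polygon m n | 0 ≤ sqSideProduct x - ε ^ 2 ∧ vertexValues f x = 0} := by
    ext x
    refine Iff.trans ?_ and_comm
    refine and_congr h.vertexValues_eq_zero_iff.symm ?_
    rw [sub_nonneg, sqSideProduct_eq, sq_le_sq₀ hε.le (sideProduct_nonneg x)]
  have h2 : truncatedConfigBoundary X n ε =
      {x : Polygon m n | sqSideProduct x - ε ^ 2 = 0 ∧ vertexValues f x = 0} := by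
    ext x
    refine Iff.trans ?_ and_comm
    refine and_congr h.vertexValues_eq_zero_iff.symm ?_
    rw [sub_eq_zero, sqSideProduct_eq, sq_eq_sq₀ (sideProduct_nonneg x) hε.le]
  have hsurj : ∀ x : Polygon m n, vertexValues f x = 0 →
      Function.Surjective (fderiv ℝ (vertexValues f : Polygon m n → ZMod n → ℝ) x) := fun x hx =>
    surjective_fderiv_vertexValues h.contDiff fun i =>
      h.fderiv_ne_zero _ (h.vertexValues_eq_zero_iff.1 hx i)
  rw [h1, h2]
  refine isSmoothSubmanifoldWithBoundary_of_regular (finrank_polygon m n)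
    (contDiff_vertexValues h.contDiff) (contDiff_sqSideProduct.sub contDiff_const)
    (fun x hx _ => hsurj x hx) fun x hx hxs => ?_
  have hxB : x ∈ truncatedConfigBoundary X n ε := by rw [h2]; exact ⟨hxs, hx⟩
  have hxc : x ∈ cyclicConfig X n := truncatedConfig_subset X n hε ⟨hxB.1, hxB.2.ge⟩
  set w := tangentialPart f x (logGradient x) with hw
  have hwt : ∀ i, fderiv ℝ f (x i) (w i) = 0 := fun i => h.fderiv_tangentialPart hxc.1 i
  have hw0 : w ≠ 0 := fun h0 => by
    have := hneg x hxB
    rw [← hw, h0, map_zero] at this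
    exact lt_irrefl _ this
  -- The derivative is `2 * ε ^ 2 * ‖w‖ ^ 2`. As `w` is tangent to `X ^ n`, it adjusts the first
  -- component of the joint differential without affecting the second.
  have hsq : fderiv ℝ (fun x : Polygon m n => sqSideProduct x - ε ^ 2) x w ≠ 0 := by
    rw [fderiv_sub_const, fderiv_sqSideProduct hxc.2, ← inner_tangentialPart hwt, ← hw, hxB.2]
    have h3 : (inner ℝ w w : ℝ) ≠ 0 := inner_self_ne_zero.2 hw0
    exact mul_ne_zero (by positivity) h3
  rintro ⟨c, y⟩
  obtain ⟨v, hv⟩ := hsurj x hx y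
  set D := fderiv ℝ (fun x : Polygon m n => sqSideProduct x - ε ^ 2) x with hD
  refine ⟨v + ((c - D v) / D w) • w, Prod.ext ?_ ?_⟩
  · change D (v + ((c - D v) / D w) • w) = c
    rw [map_add, map_smul, smul_eq_mul, div_mul_cancel₀ _ hsq]
    ring
  · change fderiv ℝ (vertexValues f : Polygon m n → ZMod n → ℝ) x (v + ((c - D v) / D w) • w) = y
    rw [map_add, map_smul, h.fderiv_vertexValues_eq_zero_iff.2 hwt, smul_zero, add_zero, hv]

theorem mem_truncatedConfig_of_isCriticalPointOn (h : IsTableFunction X f) {ε : ℝ}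
    (hneg : ∀ x : Polygon m n, x ∈ cyclicConfig X n → sideProduct x < ε →
      fderiv ℝ negPerimeter x (tangentialPart f x (logGradient x)) < 0) {x : Polygon m n}
    (hx : IsCriticalPointOn negPerimeter (cyclicConfig X n) x) : x ∈ truncatedConfig X n ε := by
  refine ⟨hx.1.1, ?_⟩
  by_contra! hlt
  exact (hneg x hx.1 hlt).ne (hx.2 _ ((h.mem_tangentSpaceOf_cyclicConfig_iff hx.1).2
    fun i => h.fderiv_tangentialPart hx.1.1 i))

end IsTableFunction

end Truncation

/-! ### Equivariant deformation into a superlevel set by iterating one homotopy. -/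

section StepHomotopy

variable {Y : Type*} [TopologicalSpace Y]

/-- The concatenation of the first `N` copies of the homotopy `S` that starts at the identity,
as a function of the time in `ℝ`. -/
def iteratedStep (S : C(I × Y, Y)) : ℕ → C(ℝ × Y, Y)
  | 0 => ContinuousMap.snd
  | N + 1 => S.comp
      (((ContinuousMap.mk (Set.projIcc (0 : ℝ) 1 zero_le_one) continuous_projIcc).comp
        (ContinuousMap.fst - ContinuousMap.const _ (N : ℝ))).prodMk (iteratedStep S N))

variable {S : C(I × Y, Y)}

lemma iteratedStep_succ (N : ℕ) (t : ℝ) (y : Y) : iteratedStep S (N + 1) (t, y) =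
    S (Set.projIcc (0 : ℝ) 1 zero_le_one (t - N), iteratedStep S N (t, y)) := rfl

lemma iteratedStep_succ_of_le (hS : ∀ y, S (0, y) = y) {N : ℕ} {t : ℝ} (h : t ≤ N) (y : Y) :
    iteratedStep S (N + 1) (t, y) = iteratedStep S N (t, y) := by
  rw [iteratedStep_succ, Set.projIcc_of_le_left zero_le_one (sub_nonpos.2 h)]
  exact hS _

/-- Copies whose turn has not come sit at parameter `0`, where `S` is the identity. This makes
`stepFlow` locally a fixed finite concatenation, hence continuous. -/
lemma iteratedStep_of_le (hS : ∀ y, S (0, y) = y) {N N' : ℕ} (hN : N ≤ N') {t : ℝ} (h : t ≤ N)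
    (y : Y) : iteratedStep S N' (t, y) = iteratedStep S N (t, y) := by
  induction N', hN using Nat.le_induction with
  | base => rfl
  | succ k hk ih => rw [iteratedStep_succ_of_le hS (h.trans (by exact_mod_cast hk)), ih]

lemma iteratedStep_of_ge {N : ℕ} {t : ℝ} (h : N ≤ t) (y : Y) :
    iteratedStep S N (t, y) = (fun y => S (1, y))^[N] y := by
  induction N with
  | zero => rfl
  | succ k ih =>
    push_cast at h
    rw [iteratedStep_succ, Set.projIcc_of_right_le zero_le_one (by linarith), ih (by linarith),
      Function.iterate_succ_apply']
    rfl

lemma iteratedStep_mono {q : Y → ℝ} (hq : ∀ s y, q y ≤ q (S (s, y))) {N N' : ℕ} (hN : N ≤ N')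
    (z : ℝ × Y) : q (iteratedStep S N z) ≤ q (iteratedStep S N' z) := by
  induction N', hN using Nat.le_induction with
  | base => rfl
  | succ k hk ih => exact ih.trans (hq _ _)

/-- The concatenation of infinitely many copies of the homotopy `S`. -/
def stepFlow (S : C(I × Y, Y)) (z : ℝ × Y) : Y := iteratedStep S ⌈z.1⌉₊ z

lemma stepFlow_eq (hS : ∀ y, S (0, y) = y) {N : ℕ} {t : ℝ} (h : t ≤ N) (y : Y) :
    stepFlow S (t, y) = iteratedStep S N (t, y) :=
  (iteratedStep_of_le hS (Nat.ceil_le.2 h) (Nat.le_ceil t) y).symm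

lemma continuous_stepFlow (hS : ∀ y, S (0, y) = y) : Continuous (stepFlow S) := by
  refine continuous_iff_continuousAt.2 fun z => ?_
  obtain ⟨N, hN⟩ := exists_nat_gt z.1
  have h1 : stepFlow S =ᶠ[𝓝 z] iteratedStep S N := by
    filter_upwards [continuous_fst.continuousAt.eventually (gt_mem_nhds hN)] with w hw
    exact stepFlow_eq hS (le_of_lt hw) w.2
  exact (iteratedStep S N).continuous.continuousAt.congr h1.symm

lemma stepFlow_zero (y : Y) : stepFlow S (0, y) = y := by
  simp [stepFlow, iteratedStep]

lemma le_stepFlow {q : Y → ℝ} (hq : ∀ s y, q y ≤ q (S (s, y))) (z : ℝ × Y) :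
    q z.2 ≤ q (stepFlow S z) :=
  iteratedStep_mono hq (Nat.zero_le _) z

lemma iterate_le_stepFlow {q : Y → ℝ} (hq : ∀ s y, q y ≤ q (S (s, y)))
    {k : ℕ} {t : ℝ} (ht : k ≤ t) (y : Y) :
    q ((fun y => S (1, y))^[k] y) ≤ q (stepFlow S (t, y)) := by
  rw [← iteratedStep_of_ge ht]
  refine iteratedStep_mono hq ?_ _
  exact_mod_cast ht.trans (Nat.le_ceil t)

variable {Γ : Type*} [Group Γ] [MulAction Γ Y]

lemma stepFlow_smul (hS : ∀ (s : I) (γ : Γ) (y : Y), S (s, γ • y) = γ • S (s, y)) (t : ℝ) (γ : Γ)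
    (y : Y) : stepFlow S (t, γ • y) = γ • stepFlow S (t, y) := by
  have h : ∀ N, iteratedStep S N (t, γ • y) = γ • iteratedStep S N (t, y) := by
    intro N
    induction N with
    | zero => rfl
    | succ k ih => rw [iteratedStep_succ, ih, hS, ← iteratedStep_succ]
  exact h _

lemma exists_lift_of_isEmbedding {A Z : Type*} [TopologicalSpace A] [TopologicalSpace Z]
    {f : C(A, Y)} (hf : Topology.IsEmbedding f) (φ : C(Z, Y)) (hφ : ∀ z, φ z ∈ Set.range f) :
    ∃ ψ : C(Z, A), ∀ z, f (ψ z) = φ z := by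
  choose ψ hψ using hφ
  refine ⟨⟨ψ, hf.isInducing.continuous_iff.2 ?_⟩, hψ⟩
  rw [show f ∘ ψ = φ from funext hψ]
  exact φ.continuous

/-- A superlevel set is an equivariant deformation retract up to homotopy, if there is an
equivariant homotopy that starts at the identity, along which the function does not decrease, and
whose iterates take every point to the superlevel set. -/
theorem isEquivariantHomotopyEquiv_of_step [T2Space Y] [ParacompactSpace Y] [Finite Γ]
    (hΓ : ∀ γ : Γ, Continuous fun y : Y => γ • y) {A : Type*} [TopologicalSpace A] [MulAction Γ A]
    {f : C(A, Y)} (hf : Topology.IsEmbedding f) (hfΓ : ∀ (γ : Γ) (a : A), f (γ • a) = γ • f a)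
    {q : Y → ℝ} (hqc : Continuous q) {r : ℝ} (hr : Set.range f = {y | r ≤ q y})
    (hS0 : ∀ y, S (0, y) = y) (hSq : ∀ s y, q y ≤ q (S (s, y)))
    (hSΓ : ∀ (s : I) (γ : Γ) (y : Y), S (s, γ • y) = γ • S (s, y))
    (hSr : ∀ y, ∃ k : ℕ, r < q ((fun y => S (1, y))^[k] y)) :
    IsEquivariantHomotopyEquiv Γ f := by
  have := Fintype.ofFinite Γ
  have hmem : ∀ a, r ≤ q (f a) := fun a => by
    have : f a ∈ {y | r ≤ q y} := hr ▸ Set.mem_range_self a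
    exact this
  have hlift : ∀ y, r ≤ q y → y ∈ Set.range f := fun y hy => by rw [hr]; exact hy
  -- The admissible stopping times at `y` form an upward closed, hence convex, set. The strict
  -- inequality in `hSr` makes one constant admissible near each point, so a partition of unity
  -- gives a continuous choice.
  obtain ⟨T, hT⟩ := exists_continuous_forall_mem_convex_of_local_const
    (t := fun y => {T : ℝ | 0 ≤ T ∧ ∀ t, T ≤ t → r ≤ q (stepFlow S (t, y))}) (by
      intro y
      refine Set.OrdConnected.convex ⟨?_⟩
      rintro a ⟨ha, ha'⟩ b - c ⟨hc, -⟩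
      exact ⟨ha.trans hc, fun t ht => ha' t (hc.trans ht)⟩) (by
      intro y
      obtain ⟨k, hk⟩ := hSr y
      have hc : Continuous fun y => (fun y => S (1, y))^[k] y :=
        Continuous.iterate (S.continuous.comp (continuous_const.prodMk continuous_id)) k
      refine ⟨k, ((hqc.comp hc).continuousAt.eventually (lt_mem_nhds hk)).mono fun w hw => ?_⟩
      exact ⟨Nat.cast_nonneg k, fun t ht => hw.le.trans (iterate_le_stepFlow hSq ht w)⟩)
  -- The sum over the finite group is invariant and, all terms being nonnegative, still at least
  -- `T`, hence admissible.
  let T' : Y → ℝ := fun y => ∑ γ : Γ, T (γ • y)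
  have hT'c : Continuous T' := continuous_finsetSum _ fun γ _ => T.continuous.comp (hΓ γ)
  have hT'Γ : ∀ (γ : Γ) (y : Y), T' (γ • y) = T' y := by
    intro γ y
    refine Fintype.sum_equiv (Equiv.mulRight γ) _ _ fun g => ?_
    rw [Equiv.coe_mulRight, mul_smul]
  have hT' : ∀ y, T y ≤ T' y := by
    intro y
    have := Finset.single_le_sum (f := fun γ : Γ => T (γ • y)) (fun γ _ => (hT _).1)
      (Finset.mem_univ (1 : Γ))
    simpa using this
  -- Parameter `0` is the retraction and `1` the identity. The superlevel set is preserved since `q`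
  -- does not decrease, so `Φ` also restricts to `A`.
  let Φ : C(I × Y, Y) := ⟨fun z => stepFlow S ((1 - (z.1 : ℝ)) * T' z.2, z.2),
    (continuous_stepFlow hS0).comp (((continuous_const.sub (continuous_subtype_val.comp
      continuous_fst)).mul (hT'c.comp continuous_snd)).prodMk continuous_snd)⟩
  have hΦ : ∀ s y, Φ (s, y) = stepFlow S ((1 - (s : ℝ)) * T' y, y) := fun _ _ => rfl
  have hΦΓ : ∀ s (γ : Γ) y, Φ (s, γ • y) = γ • Φ (s, y) := fun s γ y => by
    rw [hΦ, hΦ, hT'Γ, stepFlow_smul hSΓ]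
  have hΦ1 : ∀ y, Φ (1, y) = y := fun y => by
    rw [hΦ, Set.Icc.coe_one, sub_self, zero_mul, stepFlow_zero]
  have hΦ0 : ∀ y, r ≤ q (Φ (0, y)) := fun y => by
    rw [hΦ, Set.Icc.coe_zero, sub_zero, one_mul]
    exact (hT y).2 _ (hT' y)
  obtain ⟨g, hg⟩ := exists_lift_of_isEmbedding hf
    (Φ.comp ((ContinuousMap.const Y (0 : I)).prodMk (ContinuousMap.id Y)))
    fun y => hlift _ (hΦ0 y)
  have hg : ∀ y, f (g y) = Φ (0, y) := hg
  obtain ⟨H, hH⟩ := exists_lift_of_isEmbedding hf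
    (Φ.comp ((ContinuousMap.id I).prodMap f))
    fun z => hlift _ ((hmem z.2).trans
      (le_stepFlow hSq ((1 - (z.1 : ℝ)) * T' (f z.2), f z.2)))
  have hH : ∀ s a, f (H (s, a)) = Φ (s, f a) := fun s a => hH (s, a)
  refine ⟨hfΓ, g, fun γ y => hf.injective ?_, ?_, ?_⟩
  · rw [hfΓ, hg, hg, hΦΓ]
  · refine ⟨⟨H, fun a => hf.injective ?_, fun a => hf.injective ?_⟩,
      fun s γ a => hf.injective ?_⟩
    · change f (H (0, a)) = f (g (f a))
      rw [hH, hg]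
    · change f (H (1, a)) = f a
      rw [hH, hΦ1]
    · change f (H (s, γ • a)) = f (γ • H (s, a))
      rw [hH, hfΓ, hΦΓ, hfΓ, hH]
  · exact ⟨⟨Φ, fun y => (hg y).symm, hΦ1⟩, hΦΓ⟩

end StepHomotopy

/-! ### Flow of a tangent field on a compact level set. -/

section Semiflow

variable {E F : Type*} [NormedAddCommGroup E] [NormedSpace ℝ E]
  [NormedAddCommGroup F] [NormedSpace ℝ F]

lemma hasDerivWithinAt_comp_of_hasDerivWithinAt {g : E → F} (hg : Differentiable ℝ g) {γ : ℝ → E}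
    {v : E} {s : Set ℝ} {t : ℝ} (h : HasDerivWithinAt γ v s t) :
    HasDerivWithinAt (fun t => g (γ t)) (fderiv ℝ g (γ t) v) s t :=
  (hg (γ t)).hasFDerivAt.comp_hasDerivWithinAt t h

lemma monotoneOn_comp_of_hasDerivWithinAt {q : E → ℝ} (hq : Differentiable ℝ q) {γ γ' : ℝ → E}
    (h : ∀ t ∈ Set.Icc (0 : ℝ) 1, HasDerivWithinAt γ (γ' t) (Set.Icc 0 1) t)
    (h0 : ∀ t ∈ Set.Icc (0 : ℝ) 1, 0 ≤ fderiv ℝ q (γ t) (γ' t)) :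
    MonotoneOn (fun t => q (γ t)) (Set.Icc 0 1) := by
  have h1 := fun t ht => hasDerivWithinAt_comp_of_hasDerivWithinAt hq (h t ht)
  refine monotoneOn_of_hasDerivWithinAt_nonneg (convex_Icc 0 1)
    (fun t ht => (h1 t ht).continuousWithinAt)
    (fun t ht => (h1 t (interior_subset ht)).mono interior_subset)
    fun t ht => h0 t (interior_subset ht)

/-- A vector field tangent to the level sets of `G` has a semiflow, for times up to `1` and after
multiplication with a constant, on a compact level set. -/
theorem exists_semiflow [FiniteDimensional ℝ E] {W : E → E} (hW : ContDiff ℝ ∞ W) {G : E → F} (hG : Differentiable ℝ G)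
    (hGW : ∀ x, fderiv ℝ G x (W x) = 0) (hZ : IsCompact {x | G x = 0}) :
    ∃ c > (0 : ℝ), ∃ S : ℝ → E → E,
      ContinuousOn (fun z : ℝ × E => S z.1 z.2) (Set.Icc 0 1 ×ˢ {x | G x = 0}) ∧
      (∀ x, G x = 0 → S 0 x = x ∧ ∀ t ∈ Set.Icc (0 : ℝ) 1, G (S t x) = 0 ∧
        HasDerivWithinAt (S · x) (c • W (S t x)) (Set.Icc 0 1) t) ∧
      ∀ γ : ℝ → E, (∀ t ∈ Set.Icc (0 : ℝ) 1, G (γ t) = 0 ∧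
        HasDerivWithinAt γ (c • W (γ t)) (Set.Icc 0 1) t) →
        Set.EqOn γ (S · (γ 0)) (Set.Icc 0 1) := by
  have : CompleteSpace E := FiniteDimensional.complete ℝ E
  have : ProperSpace E := FiniteDimensional.proper ℝ E
  obtain ⟨R, hR⟩ := hZ.isBounded.subset_closedBall 0
  set r : NNReal := R.toNNReal
  set a : NNReal := r + 1
  obtain ⟨L, hL⟩ := (isCompact_closedBall (0 : E) a).exists_bound_of_continuousOn
    hW.continuous.continuousOn
  have hL0 : 0 ≤ L := (norm_nonneg _).trans (hL 0 (by simp))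
  obtain ⟨K, hK⟩ := (hW.of_le (m := 1) (by simp)).contDiffOn.exists_lipschitzOnWith one_ne_zero
    (convex_closedBall (0 : E) a) (isCompact_closedBall (0 : E) a)
  -- The rescaled field has norm at most `1` on the ball of radius `a = r + 1`, so solutions
  -- starting in the ball of radius `r` remain there up to time `1`.
  set c : ℝ := (L + 1)⁻¹
  have hc : 0 < c := by positivity
  have hLip : LipschitzOnWith (‖c‖₊ * K) (fun x => c • W x) (Metric.closedBall 0 a) := by
    intro x hx y hy
    simpa [edist_smul₀, ENNReal.smul_def, mul_assoc] using
      mul_le_mul_right (hK hx hy) (‖c‖₊ : ENNReal)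
  have hPL : IsPicardLindelof (fun _ x => c • W x) (tmin := 0) (tmax := 1)
      ⟨0, Set.left_mem_Icc.2 zero_le_one⟩ (0 : E) a r 1 (‖c‖₊ * K) := by
    refine .of_time_independent (fun x hx => ?_) hLip ?_
    · rw [norm_smul, Real.norm_of_nonneg hc.le]
      have h1 := mul_le_mul_of_nonneg_left (hL x hx) hc.le
      have h2 : c * L ≤ 1 := by
        rw [inv_mul_le_iff₀ (by positivity)]
        linarith
      exact h1.trans h2
    · simp [a]
  obtain ⟨α, hα, hαc⟩ :=
    hPL.exists_forall_mem_closedBall_eq_hasDerivWithinAt_continuousOn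
  have hZr : ∀ x, G x = 0 → x ∈ Metric.closedBall (0 : E) r := fun x hx =>
    Metric.closedBall_subset_closedBall (Real.le_coe_toNNReal R) (hR hx)
  have hZa : ∀ x, G x = 0 → x ∈ Metric.closedBall (0 : E) a := fun x hx =>
    Metric.closedBall_subset_closedBall (by simp [a]) (hZr x hx)
  have hmem : ∀ x, G x = 0 → ∀ t ∈ Set.Icc (0 : ℝ) 1, G (α (x, t)) = 0 := by
    intro x hx t ht
    have h1 := fun t ht => hasDerivWithinAt_comp_of_hasDerivWithinAt hG ((hα x (hZr x hx)).2 t ht)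
    have h2 := (convex_Icc (0 : ℝ) 1).is_const_of_fderivWithin_eq_zero (𝕜 := ℝ)
      (f := fun t => G (α (x, t))) (fun t ht => (h1 t ht).differentiableWithinAt)
      (fun t ht => ?_) ht (Set.left_mem_Icc.2 zero_le_one)
    · rw [h2]
      exact ((congrArg G (hα x (hZr x hx)).1).trans hx)
    · have h3 := (h1 t ht).hasFDerivWithinAt.fderivWithin (uniqueDiffOn_Icc zero_lt_one t ht)
      rw [h3, map_smul, hGW, smul_zero]
      simp
  refine ⟨c, hc, fun t x => α (x, t), ?_, fun x hx => ⟨(hα x (hZr x hx)).1, fun t ht =>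
    ⟨hmem x hx t ht, (hα x (hZr x hx)).2 t ht⟩⟩, fun γ hγ => ?_⟩
  · exact hαc.comp continuous_swap.continuousOn fun z hz => ⟨hZr _ hz.2, hz.1⟩
  have hγ0 := (hγ 0 (Set.left_mem_Icc.2 zero_le_one)).1
  have hright : ∀ {β : ℝ → E} {v : E} {t : ℝ}, t ∈ Set.Ico (0 : ℝ) 1 →
      HasDerivWithinAt β v (Set.Icc 0 1) t → HasDerivWithinAt β v (Set.Ici t) t :=
    fun ht h => h.mono_of_mem_nhdsWithin (Icc_mem_nhdsGE_of_mem ht)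
  refine ODE_solution_unique_of_mem_Icc_right (v := fun _ x => c • W x)
    (s := fun _ => Metric.closedBall 0 a) (fun _ _ => hLip)
    (fun t ht => (hγ t ht).2.continuousWithinAt)
    (fun t ht => hright ht (hγ t (Set.Ico_subset_Icc_self ht)).2)
    (fun t ht => hZa _ (hγ t (Set.Ico_subset_Icc_self ht)).1)
    (fun t ht => ((hα _ (hZr _ hγ0)).2 t ht).continuousWithinAt)
    (fun t ht => hright ht ((hα _ (hZr _ hγ0)).2 t (Set.Ico_subset_Icc_self ht)))
    (fun t ht => hZa _ (hmem _ hγ0 t (Set.Ico_subset_Icc_self ht)))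
    (hα _ (hZr _ hγ0)).1.symm

end Semiflow

lemma contDiff_gradient {E : Type*} [NormedAddCommGroup E] [InnerProductSpace ℝ E]
    [CompleteSpace E] {f : E → ℝ} (hf : ContDiff ℝ ∞ f) : ContDiff ℝ ∞ (gradient f) :=
  (InnerProductSpace.toDual ℝ E).symm.toContinuousLinearEquiv.contDiff.comp
    (contDiff_infty_iff_fderiv.1 hf).2

lemma isCompact_forall_mem {m n : ℕ} {X : Set (EuclideanSpace ℝ (Fin (m + 1)))} (hX : IsCompact X) :
    IsCompact {x : Polygon m n | ∀ i, x i ∈ X} := by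
  convert (isCompact_univ_pi fun _ : ZMod n => hX).image
    (PiLp.continuous_toLp 2 fun _ : ZMod n => EuclideanSpace ℝ (Fin (m + 1))) using 1
  ext x
  refine ⟨fun hx => ⟨x.ofLp, fun i _ => hx i, rfl⟩, ?_⟩
  rintro ⟨y, hy, rfl⟩ i
  exact hy i trivial

/-! ### An equivariant field that increases the product of the sides. -/

section Ascent

variable {m n : ℕ} [NeZero n]

/-- A vector field tangent to the level sets of `f` at all vertices, along which the product of the
sides does not decrease. -/
def ascentField (f : EuclideanSpace ℝ (Fin (m + 1)) → ℝ) (x : Polygon m n) : Polygon m n :=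
  WithLp.toLp 2 fun i => ‖gradient f (x i)‖ ^ 2 • gradient sqSideProduct x i -
    inner ℝ (gradient sqSideProduct x i) (gradient f (x i)) • gradient f (x i)

lemma ascentField_apply (f : EuclideanSpace ℝ (Fin (m + 1)) → ℝ) (x : Polygon m n) (i : ZMod n) :
    ascentField f x i = ‖gradient f (x i)‖ ^ 2 • gradient sqSideProduct x i -
      inner ℝ (gradient sqSideProduct x i) (gradient f (x i)) • gradient f (x i) := rfl

lemma contDiff_ascentField {f : EuclideanSpace ℝ (Fin (m + 1)) → ℝ} (hf : ContDiff ℝ ∞ f) :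
    ContDiff ℝ ∞ (ascentField f : Polygon m n → Polygon m n) := by
  refine contDiff_piLp' _ fun i => ?_
  have h1 : ContDiff ℝ ∞ fun x : Polygon m n => gradient f (x i) :=
    (contDiff_gradient hf).comp (vertexL m n i).contDiff
  have h2 : ContDiff ℝ ∞ fun x : Polygon m n => gradient sqSideProduct x i :=
    (vertexL m n i).contDiff.comp (contDiff_gradient contDiff_sqSideProduct)
  exact ((h1.norm_sq ℝ).smul h2).sub ((h2.inner ℝ h1).smul h1)

lemma fderiv_ascentField_apply (f : EuclideanSpace ℝ (Fin (m + 1)) → ℝ) (x : Polygon m n)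
    (i : ZMod n) : fderiv ℝ f (x i) (ascentField f x i) = 0 := by
  rw [← inner_gradient_eq, ascentField_apply, inner_sub_right, real_inner_smul_right,
    real_inner_smul_right, real_inner_self_eq_norm_sq, real_inner_comm]
  ring

lemma fderiv_vertexValues_ascentField {f : EuclideanSpace ℝ (Fin (m + 1)) → ℝ}
    (hf : ContDiff ℝ ∞ f) (x : Polygon m n) :
    fderiv ℝ (vertexValues f : Polygon m n → ZMod n → ℝ) x (ascentField f x) = 0 :=
  funext fun i => (fderiv_vertexValues hf x _ i).trans (fderiv_ascentField_apply f x i)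

/-- Each summand is the Gram determinant of the vertex component of the gradient and the normal:
nonnegative, and zero only if they are parallel. -/
lemma fderiv_sqSideProduct_ascentField (f : EuclideanSpace ℝ (Fin (m + 1)) → ℝ)
    (x : Polygon m n) : fderiv ℝ sqSideProduct x (ascentField f x) =
      ∑ i, ((‖gradient sqSideProduct x i‖ * ‖gradient f (x i)‖) ^ 2 -
        inner ℝ (gradient sqSideProduct x i) (gradient f (x i)) ^ 2) := by
  rw [← inner_gradient_eq, PiLp.inner_apply]
  refine Finset.sum_congr rfl fun i _ => ?_
  rw [ascentField_apply, inner_sub_right, real_inner_smul_right,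
    real_inner_smul_right, real_inner_self_eq_norm_sq]
  ring

lemma sq_inner_le_sq_norm_mul_norm {E : Type*} [NormedAddCommGroup E] [InnerProductSpace ℝ E]
    (a b : E) : inner ℝ a b ^ 2 ≤ (‖a‖ * ‖b‖) ^ 2 :=
  sq_le_sq' (neg_le_of_abs_le (abs_real_inner_le_norm a b)) (real_inner_le_norm a b)

lemma fderiv_sqSideProduct_ascentField_nonneg (f : EuclideanSpace ℝ (Fin (m + 1)) → ℝ)
    (x : Polygon m n) : 0 ≤ fderiv ℝ sqSideProduct x (ascentField f x) := by
  rw [fderiv_sqSideProduct_ascentField]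
  exact Finset.sum_nonneg fun i _ => sub_nonneg.2 (sq_inner_le_sq_norm_mul_norm _ _)

lemma exists_linearIsometryEquiv_smul (g : DihedralGroup n) :
    ∃ T : Polygon m n ≃ₗᵢ[ℝ] Polygon m n, ∀ x, g • x = T x := by
  rcases g with a | a
  · exact ⟨LinearIsometryEquiv.piLpCongrLeft 2 ℝ _ (Equiv.addRight a).symm, fun x => rfl⟩
  · exact ⟨LinearIsometryEquiv.piLpCongrLeft 2 ℝ _ (Equiv.subLeft a).symm, fun x => rfl⟩

lemma gradient_sqSideProduct_smul (g : DihedralGroup n) (x : Polygon m n) :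
    gradient sqSideProduct (g • x) = g • gradient sqSideProduct x := by
  obtain ⟨T, hT⟩ := exists_linearIsometryEquiv_smul (m := m) g
  have h1 : (sqSideProduct ∘ T : Polygon m n → ℝ) = sqSideProduct := funext fun y => by
    rw [Function.comp_apply, ← hT, sqSideProduct_eq, sideProduct_smul, sqSideProduct_eq]
  have hd : Differentiable ℝ (sqSideProduct : Polygon m n → ℝ) :=
    contDiff_sqSideProduct.differentiable (by simp)
  refine ext_inner_right ℝ fun w => ?_
  obtain ⟨v, rfl⟩ := T.surjective w
  rw [hT, hT, T.inner_map_map, inner_gradient_eq, inner_gradient_eq]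
  have h2 : HasFDerivAt (sqSideProduct ∘ T : Polygon m n → ℝ) _ x :=
    (hd (T x)).hasFDerivAt.comp x T.toContinuousLinearEquiv.hasFDerivAt
  rw [h1] at h2
  rw [h2.fderiv]
  rfl

lemma ascentField_smul (f : EuclideanSpace ℝ (Fin (m + 1)) → ℝ) (g : DihedralGroup n)
    (x : Polygon m n) : ascentField f (g • x) = g • ascentField f x := by
  ext1 i
  rw [ascentField_apply, gradient_sqSideProduct_smul]
  rcases g with a | a <;> rfl

namespace IsTableFunction

variable {X : Set (EuclideanSpace ℝ (Fin (m + 1)))} {f : EuclideanSpace ℝ (Fin (m + 1)) → ℝ}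

/-- If the derivative vanished, the gradient of `sqSideProduct` would be normal to `X` at every
vertex and annihilate the tangent vector `w`. But its pairing with `w` is a positive multiple of
`‖w‖ ^ 2`, and `w ≠ 0` by `hneg`. -/
lemma fderiv_sqSideProduct_ascentField_pos (h : IsTableFunction X f) {x : Polygon m n}
    (hx : x ∈ cyclicConfig X n)
    (hneg : fderiv ℝ negPerimeter x (tangentialPart f x (logGradient x)) < 0) :
    0 < fderiv ℝ sqSideProduct x (ascentField f x) := by
  refine (fderiv_sqSideProduct_ascentField_nonneg f x).lt_of_ne' fun h0 => hneg.ne ?_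
  set w := tangentialPart f x (logGradient x) with hw
  have hwf : ∀ i, fderiv ℝ f (x i) (w i) = 0 := fun i => h.fderiv_tangentialPart hx.1 i
  rw [fderiv_sqSideProduct_ascentField, Finset.sum_eq_zero_iff_of_nonneg
    fun i _ => sub_nonneg.2 (sq_inner_le_sq_norm_mul_norm _ _)] at h0
  have h1 : fderiv ℝ sqSideProduct x w = 0 := by
    rw [← inner_gradient_eq, PiLp.inner_apply]
    refine Finset.sum_eq_zero fun i _ => ?_
    have hν : gradient f (x i) ≠ 0 := by
      rw [← norm_ne_zero_iff, norm_gradient, norm_ne_zero_iff]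
      exact h.fderiv_ne_zero _ (hx.1 i)
    have h2 := h0 i (Finset.mem_univ i)
    set q := gradient sqSideProduct x i
    set ν := gradient f (x i)
    have h3 : ‖‖ν‖ ^ 2 • q - inner ℝ q ν • ν‖ ^ 2 = 0 := by
      rw [norm_sub_sq_real, norm_smul, norm_smul, real_inner_smul_left, real_inner_smul_right,
        mul_pow, mul_pow, Real.norm_eq_abs, Real.norm_eq_abs, sq_abs, sq_abs]
      linear_combination ‖ν‖ ^ 2 * h2
    have h4 : ‖ν‖ ^ 2 • q = inner ℝ q ν • ν := by
      rwa [sq_eq_zero_iff, norm_eq_zero, sub_eq_zero] at h3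
    have h5 : ‖ν‖ ^ 2 * inner ℝ q (w i) = 0 := by
      rw [← real_inner_smul_left, h4, real_inner_smul_left, inner_gradient_eq, hwf, mul_zero]
    exact (mul_eq_zero.1 h5).resolve_left (pow_ne_zero 2 (norm_ne_zero_iff.2 hν))
  rw [fderiv_sqSideProduct hx.2, ← inner_tangentialPart hwf] at h1
  have h2 : w = 0 := inner_self_eq_zero.1
    ((mul_eq_zero.1 h1).resolve_left (mul_ne_zero two_ne_zero
      (pow_ne_zero 2 (sideProduct_pos_iff.2 hx.2).ne')))
  rw [h2, map_zero]

theorem isEquivariantHomotopyEquiv_inclusion (h : IsTableFunction X f) {ε : ℝ} (hε : 0 < ε)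
    (hneg : ∀ x : Polygon m n, x ∈ cyclicConfig X n → sideProduct x ≤ ε →
      fderiv ℝ negPerimeter x (tangentialPart f x (logGradient x)) < 0) :
    IsEquivariantHomotopyEquiv (DihedralGroup n)
      (ContinuousMap.inclusion (truncatedConfig_subset X n hε)) := by
  have hQd : Differentiable ℝ (sqSideProduct : Polygon m n → ℝ) :=
    contDiff_sqSideProduct.differentiable (by simp)
  have hQc : Continuous (sqSideProduct : Polygon m n → ℝ) := hQd.continuous
  have hZ : {x : Polygon m n | vertexValues f x = 0} = {x | ∀ i, x i ∈ X} :=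
    Set.ext fun x => h.vertexValues_eq_zero_iff
  have hZc : IsCompact {x : Polygon m n | vertexValues f x = 0} :=
    hZ ▸ isCompact_forall_mem h.isCompact
  obtain ⟨c, hc, S, hSc, hS, hSu⟩ := exists_semiflow (contDiff_ascentField h.contDiff)
    ((contDiff_vertexValues h.contDiff).differentiable (by simp))
    (fderiv_vertexValues_ascentField h.contDiff) hZc
  have hmono : ∀ x, vertexValues f x = 0 →
      MonotoneOn (fun t => sqSideProduct (S t x)) (Set.Icc 0 1) := fun x hx =>
    monotoneOn_comp_of_hasDerivWithinAt hQd (fun t ht => ((hS x hx).2 t ht).2) fun t ht => by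
      rw [map_smul]
      exact mul_nonneg hc.le (fderiv_sqSideProduct_ascentField_nonneg f _)
  have h0 : (0 : ℝ) ∈ Set.Icc (0 : ℝ) 1 := Set.left_mem_Icc.2 zero_le_one
  have h1 : (1 : ℝ) ∈ Set.Icc (0 : ℝ) 1 := Set.right_mem_Icc.2 zero_le_one
  have hQS : ∀ x, vertexValues f x = 0 → ∀ t ∈ Set.Icc (0 : ℝ) 1,
      sqSideProduct x ≤ sqSideProduct (S t x) := fun x hx t ht => by
    simpa only [(hS x hx).1] using hmono x hx h0 ht ht.1
  have hpos : ∀ x : Polygon m n, (∀ i, x i ≠ x (i + 1)) ↔ 0 < sqSideProduct x := fun x => by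
    rw [sqSideProduct_eq, ← sideProduct_pos_iff]
    exact ⟨fun hx => pow_pos hx 2, fun hx =>
      (sideProduct_nonneg x).lt_of_ne' fun h' => by simp [h'] at hx⟩
  have hle : ∀ x : Polygon m n, sqSideProduct x ≤ ε ^ 2 ↔ sideProduct x ≤ ε := fun x => by
    rw [sqSideProduct_eq, pow_le_pow_iff_left₀ (sideProduct_nonneg x) hε.le two_ne_zero]
  have hstrict : ∀ x ∈ cyclicConfig X n, sqSideProduct x ≤ ε ^ 2 →
      sqSideProduct x < sqSideProduct (S 1 x) := by
    intro x hx hxε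
    have hx0 := h.vertexValues_eq_zero_iff.2 hx.1
    -- Equality at time `1` would make the monotone function constant, against its positive
    -- derivative at time `0`.
    refine (hQS x hx0 1 h1).lt_of_ne fun heq => ?_
    have hd := hasDerivWithinAt_comp_of_hasDerivWithinAt hQd ((hS x hx0).2 0 h0).2
    have hconst : HasDerivWithinAt (fun t => sqSideProduct (S t x)) 0 (Set.Icc 0 1) 0 := by
      refine (hasDerivWithinAt_const (0 : ℝ) _ (sqSideProduct x)).congr_of_mem (fun t ht => ?_) h0
      exact ((hmono x hx0 ht h1 ht.2).trans heq.ge).antisymm (hQS x hx0 t ht)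
    have hz := (uniqueDiffOn_Icc zero_lt_one 0 h0).eq_deriv _ hd hconst
    rw [(hS x hx0).1, map_smul] at hz
    exact (mul_pos hc (h.fderiv_sqSideProduct_ascentField_pos hx
      (hneg x hx ((hle x).1 hxε)))).ne' hz
  have hmem : ∀ x ∈ cyclicConfig X n, ∀ t ∈ Set.Icc (0 : ℝ) 1, S t x ∈ cyclicConfig X n := by
    intro x hx t ht
    have hx0 := h.vertexValues_eq_zero_iff.2 hx.1
    exact ⟨h.vertexValues_eq_zero_iff.1 ((hS x hx0).2 t ht).1,
      (hpos _).2 (((hpos x).1 hx.2).trans_le (hQS x hx0 t ht))⟩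
  have hequiv : ∀ (g : DihedralGroup n), ∀ x ∈ cyclicConfig X n, ∀ t ∈ Set.Icc (0 : ℝ) 1,
      S t (g • x) = g • S t x := by
    intro g x hx t ht
    obtain ⟨T, hT⟩ := exists_linearIsometryEquiv_smul (m := m) g
    have hx0 := h.vertexValues_eq_zero_iff.2 hx.1
    -- The translate of a solution solves the same equation because the field is equivariant;
    -- uniqueness does the rest.
    have h2 := hSu (fun t => g • S t x) fun t ht => ⟨h.vertexValues_eq_zero_iff.2
      (smul_mem_cyclicConfig g (hmem x hx t ht)).1, ?_⟩
    · have h3 := h2 ht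
      simp only [(hS x hx0).1] at h3
      exact h3.symm
    · rw [ascentField_smul]
      simp only [hT]
      rw [← T.map_smul]
      exact T.toContinuousLinearEquiv.hasFDerivAt.comp_hasDerivWithinAt t ((hS x hx0).2 t ht).2
  let Φ : C(I × cyclicConfig X n, cyclicConfig X n) :=
    ⟨fun z => ⟨S z.1 z.2, hmem _ z.2.2 _ z.1.2⟩, (hSc.comp_continuous
      (f := fun z : I × cyclicConfig X n => ((z.1 : ℝ), (z.2 : Polygon m n))) (by fun_prop)
      fun z => ⟨z.1.2, h.vertexValues_eq_zero_iff.2 z.2.2.1⟩).subtype_mk _⟩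
  refine isEquivariantHomotopyEquiv_of_step (S := Φ)
    (q := fun y : cyclicConfig X n => sqSideProduct y.1) (r := ε ^ 2) (fun g => ?_)
    (Topology.IsEmbedding.inclusion (truncatedConfig_subset X n hε)) (fun _ _ => rfl)
    (hQc.comp continuous_subtype_val) ?_ (fun y => Subtype.ext (hS _
      (h.vertexValues_eq_zero_iff.2 y.2.1)).1)
    (fun s y => hQS _ (h.vertexValues_eq_zero_iff.2 y.2.1) s s.2)
    (fun s g y => Subtype.ext (hequiv g y y.2 s s.2)) fun y => ?_
  · obtain ⟨T, hT⟩ := exists_linearIsometryEquiv_smul (m := m) g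
    refine Continuous.subtype_mk ?_ _
    simp only [hT]
    exact T.continuous.comp continuous_subtype_val
  · ext y
    have h2 : ε ^ 2 ≤ sqSideProduct y.1 ↔ ε ≤ sideProduct y.1 := by
      rw [sqSideProduct_eq, pow_le_pow_iff_left₀ hε.le (sideProduct_nonneg _) two_ne_zero]
    refine ⟨?_, fun hy => ⟨⟨y.1, y.2.1, h2.1 hy⟩, rfl⟩⟩
    rintro ⟨z, rfl⟩
    exact h2.2 z.2.2
  · by_contra! hy
    -- An orbit that never rises above `ε ^ 2` would remain in this compact set, where one step
    -- gains at least a fixed `δ > 0`.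
    set K : Set (Polygon m n) := {x | vertexValues f x = 0} ∩
      {x | sqSideProduct y.1 ≤ sqSideProduct x ∧ sqSideProduct x ≤ ε ^ 2}
    have hK : IsCompact K := hZc.inter_right
      ((isClosed_le continuous_const hQc).inter (isClosed_le hQc continuous_const))
    have hS1 : ContinuousOn (fun x => S 1 x) K :=
      hSc.comp (f := fun x : Polygon m n => ((1 : ℝ), x)) (by fun_prop) fun x hx => ⟨h1, hx.1⟩
    obtain ⟨δ, hδ, hKδ⟩ := hK.exists_forall_le' (f := fun x => sqSideProduct (S 1 x) -
      sqSideProduct x) (a := 0) ((hQc.comp_continuousOn hS1).sub hQc.continuousOn)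
      fun x hx => sub_pos.2 (hstrict x ⟨h.vertexValues_eq_zero_iff.1 hx.1,
        (hpos x).2 (((hpos y.1).1 y.2.2).trans_le hx.2.1)⟩ hx.2.2)
    have hiter : ∀ k : ℕ, sqSideProduct y.1 + k * δ ≤
        sqSideProduct ((fun y => Φ (1, y))^[k] y).1 := by
      intro k
      induction k with
      | zero => simp
      | succ k ih =>
        rw [Function.iterate_succ_apply']
        set z := (fun y => Φ (1, y))^[k] y with hz
        have h2 : δ ≤ sqSideProduct (S 1 z.1) - sqSideProduct z.1 := hKδ z.1
          ⟨h.vertexValues_eq_zero_iff.2 z.2.1, le_trans (by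
            have : 0 ≤ k * δ := by positivity
            linarith) ih, hy k⟩
        change _ ≤ sqSideProduct (S 1 z.1)
        push_cast
        linarith
    obtain ⟨k, hk⟩ := exists_nat_gt (ε ^ 2 / δ)
    rw [div_lt_iff₀ hδ] at hk
    have h2 := (hiter k).trans (hy k)
    linarith [(hpos y.1).1 y.2.2]

end IsTableFunction

end Ascent

end Billiard

end

/-! ### The four assertions from the one inequality. -/

theorem mainTheorem10 (m n : ℕ) [NeZero m] [NeZero n]
    (X : Set (EuclideanSpace ℝ (Fin (m + 1))))
    (hX : Billiard.IsClosedStrictlyConvexHypersurface X) :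
    ∃ ε₀ : ℝ, 0 < ε₀ ∧ ∀ (ε : ℝ) (hε : 0 < ε), ε < ε₀ →
      Billiard.IsSmoothSubmanifoldWithBoundary (m * n)
        (Billiard.truncatedConfig X n ε) (Billiard.truncatedConfigBoundary X n ε) ∧
      Billiard.IsEquivariantHomotopyEquiv (DihedralGroup n)
        (ContinuousMap.inclusion (Billiard.truncatedConfig_subset X n hε)) ∧
      (∀ x, Billiard.IsCriticalPointOn Billiard.negPerimeter (Billiard.cyclicConfig X n) x →
        x ∈ Billiard.truncatedConfig X n ε) ∧
      (∀ x ∈ Billiard.truncatedConfigBoundary X n ε,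
        Billiard.IsOutwardAt (Billiard.truncatedConfig X n ε)
          (Billiard.truncatedConfigBoundary X n ε) x
          (Billiard.gradientOn Billiard.negPerimeter (Billiard.cyclicConfig X n) x)) := by
  obtain ⟨f, h⟩ := hX.exists_isTableFunction
  obtain ⟨ε₀, hε₀, hneg⟩ := h.exists_fderiv_negPerimeter_neg (n := n)
  refine ⟨ε₀, hε₀, fun ε hε hlt => ?_⟩
  have hbd : ∀ x ∈ Billiard.truncatedConfigBoundary X n ε,
      fderiv ℝ Billiard.negPerimeter x
        (Billiard.tangentialPart f x (Billiard.logGradient x)) < 0 := fun x hx =>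
    hneg x (Billiard.truncatedConfig_subset X n hε ⟨hx.1, hx.2.ge⟩) (hx.2.trans_lt hlt)
  exact ⟨h.isSmoothSubmanifoldWithBoundary_truncatedConfig hε hbd,
    h.isEquivariantHomotopyEquiv_inclusion hε fun x hx hxε => hneg x hx (hxε.trans_lt hlt),
    fun x hx => h.mem_truncatedConfig_of_isCriticalPointOn
      (fun y hy hyε => hneg y hy (hyε.trans hlt)) hx,
    fun x hx => h.isOutwardAt_gradientOn hε hx (hbd x hx)⟩
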